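/- All graphs are finite, without loops or parallel edges; $|G|$ denotes the number of vertices of $G$ and $\overline{G}$ its complement. A \emph{hole} in $G$ is an induced cycle of length at least four, and an \emph{antihole} in $G$ of length $\ell$ is an induced subgraph whose complement is a hole of length $\ell$ in $\overline{G}$. A \emph{pure pair} in $G$ is a pair $A,B$ of disjoint subsets of $V(G)$ such that either every vertex of $A$ is adjacent to every vertex of $B$, or no vertex of $A$ is adjacent to a vertex of $B$. Theorem. Let $c>0$ be a real number such that $1/c$ is an integer, and let $\ell_1,\ell_2\ge 4/c+5$ be integers. Then there exists $\varepsilon>0$ such that every graph $G$ with $|G|>1$ that has no hole of length exactly $\ell_1$ and no antihole of length exactly $\ell_2$ has a pure pair $A,B$ with $|A|\ge\varepsilon|G|$ and $|B|\ge\varepsilon|G|^{1-c}$. -/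

import Mathlib

namespace PurePairs

/-- `A` is anticomplete to `B` in `G`: no vertex in `A` has a neighbour in `B`. -/
def IsAnticomplete {V : Type*} (G : SimpleGraph V) (A B : Finset V) : Prop :=
  ∀ a ∈ A, ∀ b ∈ B, ¬ G.Adj a b

/-- A pure pair in `G`: disjoint sets of vertices that are complete or anticomplete. -/
def IsPurePair {V : Type*} (G : SimpleGraph V) (A B : Finset V) : Prop :=
  Disjoint A B ∧ (G.IsCompleteBetween (A : Set V) (B : Set V) ∨ IsAnticomplete G A B)

/-- `G` has a hole of length exactly `l`: an induced subgraph isomorphic to the cycle of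
length `l`, where `l` is at least four. -/
def HasHole {V : Type*} (G : SimpleGraph V) (l : ℕ) : Prop :=
  4 ≤ l ∧ (SimpleGraph.cycleGraph l).IsIndContained G

/-- `G` has an antihole of length exactly `l`: some set of vertices induces a hole of length `l`
in the complement graph. -/
def HasAntihole {V : Type*} (G : SimpleGraph V) (l : ℕ) : Prop :=
  HasHole Gᶜ l

end PurePairs

/-!
By Rödl's theorem, a graph without induced `ℓ`-cycle contains a vertex set of linear size inducing a
subgraph that is very sparse or has a very sparse complement, so after complementation the graph may
be assumed to be sparse.

Suppose that, for every `ε`, some `ε`-sparse graph on `n` vertices without induced `ℓ`-cycle has no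
anticomplete pair of sizes `ε n` and `ε n ^ (1 - c)`. In an ultraproduct of such graphs as `ε → 0`,
call an internal set big if it has at least a fixed positive proportion of the vertices. Then a big
set has neighbours in every big set, while vertex neighbourhoods are not big. Moreover, sets expand:
every big set contains a vertex from which a bounded number of steps through disjoint big sets
reaches a big part of every big set, the bound being about `1 / c` because expansion gains only a
factor of order `n ^ c` per step. Halving big sets therefore produces induced paths of flexible
lengths between prescribed big regions, and two such paths from a common apex can be closed to an
induced cycle of length exactly `ℓ`, which by Łoś's theorem already appears in one of the graphs.
-/

namespace PurePairs

/-! ### Induced paths and induced cycles -/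

section Paths

variable {X Y : Type*} {G : SimpleGraph X}

/-- The list of vertices of an induced path: consecutive vertices are adjacent, other pairs are
not. Distinctness is not required: for the long cycles built from such paths it follows from the
adjacencies, since a long cycle has no two vertices with the same neighbours. -/
inductive IsInducedPath (G : SimpleGraph X) : List X → Prop
  | singleton (a : X) : IsInducedPath G [a]
  | cons {a b : X} {l : List X} (hab : G.Adj a b) (hal : ∀ c ∈ l, ¬ G.Adj a c)
      (hbl : IsInducedPath G (b :: l)) : IsInducedPath G (a :: b :: l)

theorem IsInducedPath.pair {a b : X} (hab : G.Adj a b) : IsInducedPath G [a, b] :=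
  .cons hab (by simp) (.singleton b)

theorem IsInducedPath.append {l₁ l₂ : List X} {x : X} (h₁ : IsInducedPath G (l₁ ++ [x]))
    (h₂ : IsInducedPath G (x :: l₂)) (h : ∀ c ∈ l₁, ∀ d ∈ l₂, ¬ G.Adj c d) :
    IsInducedPath G (l₁ ++ x :: l₂) := by
  induction l₁ with
  | nil => exact h₂
  | cons a l₁ ih =>
    rw [List.forall_mem_cons] at h
    rcases l₁ with _ | ⟨b, l₁⟩
    · obtain ⟨⟩ | ⟨hax, -, -⟩ := h₁
      exact .cons hax h.1 h₂
    · obtain ⟨⟩ | ⟨hab, hal, hl⟩ := h₁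
      refine .cons hab (fun c hc => ?_) (ih hl h.2)
      obtain hc | rfl | hc : c ∈ l₁ ∨ c = x ∨ c ∈ l₂ := by simpa using hc
      · exact hal c (by simp [hc])
      · exact hal c (by simp)
      · exact h.1 c hc

theorem IsInducedPath.reverse {l : List X} (h : IsInducedPath G l) :
    IsInducedPath G l.reverse := by
  induction h with
  | singleton a => exact .singleton a
  | @cons a b l hab hal _ ih =>
    have hpath : IsInducedPath G (l.reverse ++ b :: [a]) := by
      refine .append (by simpa using ih) (.pair hab.symm) fun c hc d hd => ?_
      rw [List.mem_singleton.1 hd, G.adj_comm]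
      exact hal c (List.mem_reverse.1 hc)
    simpa using hpath

theorem IsInducedPath.adj_getElem_iff {l : List X} (h : IsInducedPath G l) {i j : ℕ}
    (hij : i < j) (hj : j < l.length) : G.Adj l[i] l[j] ↔ j = i + 1 := by
  induction h generalizing i j with
  | singleton a => simp at hj; omega
  | @cons a b l hab hal _ ih =>
    obtain ⟨j, rfl⟩ := Nat.exists_eq_add_one_of_ne_zero (Nat.ne_zero_of_lt hij)
    rcases i with _ | i
    · rcases j with _ | j
      · simpa using hab
      · simpa using hal _ (List.getElem_mem (by simpa using hj))
    · simpa using ih (by omega) (by simpa using hj)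

theorem isIndContained_of_comap_eq {H : SimpleGraph Y} (hH : Function.Injective H.neighborSet)
    {f : Y → X} (hf : G.comap f = H) : H.IsIndContained G := by
  subst hf
  refine ⟨⟨⟨f, fun a b hab => hH ?_⟩, Iff.rfl⟩⟩
  ext c
  simp [hab]

theorem cycleGraph_neighborSet_injective {n : ℕ} (hn : 5 ≤ n) :
    Function.Injective (SimpleGraph.cycleGraph n).neighborSet := by
  obtain ⟨n, rfl⟩ : ∃ m, n = m + 5 := ⟨n - 5, by omega⟩
  intro u v huv
  rw [SimpleGraph.cycleGraph_neighborSet, SimpleGraph.cycleGraph_neighborSet] at huv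
  have hne : (1 + 1 : Fin (n + 5)) + (1 + 1) ≠ 0 := by
    simp [Fin.ext_iff, Fin.val_add, Nat.mod_eq_of_lt]
  have h₁ : u + 1 = v - 1 ∨ u + 1 = v + 1 := by
    simpa using (Set.ext_iff.1 huv (u + 1)).1 (by simp)
  have h₂ : u - 1 = v - 1 ∨ u - 1 = v + 1 := by
    simpa using (Set.ext_iff.1 huv (u - 1)).1 (by simp)
  grind

theorem cycleGraph_adj_of_lt {n : ℕ} {i j : Fin n} (hij : i < j) :
    (SimpleGraph.cycleGraph n).Adj i j ↔ (j : ℕ) = i + 1 ∨ (i : ℕ) = 0 ∧ (j : ℕ) + 1 = n := by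
  rw [SimpleGraph.cycleGraph_adj', Fin.sub_val_of_le hij.le, Fin.coe_sub_iff_lt.2 hij]
  have := j.isLt
  omega

theorem IsInducedPath.isIndContained_cycleGraph {x y z : X} {l : List X}
    (h : IsInducedPath G (y :: (l ++ [z]))) (hl : 2 ≤ l.length) (hxy : G.Adj x y)
    (hxz : G.Adj x z) (hxl : ∀ c ∈ l, ¬ G.Adj x c) :
    (SimpleGraph.cycleGraph (l.length + 3)).IsIndContained G := by
  let f : Fin (l.length + 3) → X := fun i =>
    (x :: y :: (l ++ [z]))[i]'(by have := i.isLt; simp; omega)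
  have hf_lt : ∀ i j, i < j →
      (G.Adj (f i) (f j) ↔ (SimpleGraph.cycleGraph (l.length + 3)).Adj i j) := by
    rintro ⟨i, hi⟩ ⟨j, hj⟩ (hij : i < j)
    rw [cycleGraph_adj_of_lt hij]
    obtain ⟨j, rfl⟩ := Nat.exists_eq_add_one_of_ne_zero (Nat.ne_zero_of_lt hij)
    rcases i with _ | i
    · rcases j with _ | j
      · simpa [f] using hxy
      · obtain hj | rfl : j < l.length ∨ j = l.length := by omega
        · simpa [f, hj, hj.ne] using hxl _ (List.getElem_mem hj)
        · simpa [f] using hxz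
    · exact (h.adj_getElem_iff (i := i) (j := j) (by omega) (by simp; omega)).trans (by simp)
  refine isIndContained_of_comap_eq (cycleGraph_neighborSet_injective (by omega)) (f := f) ?_
  ext i j
  rcases lt_trichotomy i j with hij | rfl | hij
  · exact hf_lt i j hij
  · simp
  · exact (G.adj_comm _ _).trans ((hf_lt j i hij).trans (SimpleGraph.adj_comm _ _ _))

theorem isIndContained_cycleGraph_of_paths {a b : List X} {v x y : X}
    (ha : IsInducedPath G (y :: (a ++ [v]))) (hb : IsInducedPath G (x :: (b ++ [v])))
    (hlen : 2 ≤ a.length + b.length) (hxy : G.Adj x y) (hxa : ∀ c ∈ a, ¬ G.Adj x c)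
    (hyb : ∀ d ∈ b, ¬ G.Adj y d) (hab : ∀ c ∈ a, ∀ d ∈ b, ¬ G.Adj c d) :
    (SimpleGraph.cycleGraph (a.length + b.length + 3)).IsIndContained G := by
  rcases b with _ | ⟨z, b⟩
  · obtain ⟨⟩ | ⟨hxv, -, -⟩ := hb
    exact ha.isIndContained_cycleGraph hlen hxy hxv hxa
  · obtain ⟨hxz, hxb, hb⟩ :
        G.Adj x z ∧ (∀ c ∈ b ++ [v], ¬ G.Adj x c) ∧ IsInducedPath G (z :: (b ++ [v])) := by
      cases hb with | cons hxz hxb hb => exact ⟨hxz, hxb, hb⟩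
    have hpath : IsInducedPath G (y :: ((a ++ v :: b.reverse) ++ [z])) := by
      have hb' : IsInducedPath G (v :: (b.reverse ++ [z])) := by simpa using hb.reverse
      have hnadj : ∀ c ∈ y :: a, ∀ d ∈ b.reverse ++ [z], ¬ G.Adj c d := by
        simp only [List.mem_cons, List.mem_append, List.mem_reverse] at *
        grind
      simpa using IsInducedPath.append (l₁ := y :: a) ha hb' hnadj
    have hxl : ∀ c ∈ a ++ v :: b.reverse, ¬ G.Adj x c := by
      simp only [List.mem_cons, List.mem_append, List.mem_reverse] at hxb ⊢
      grind
    have hl : (a ++ v :: b.reverse).length = a.length + (z :: b).length := by simp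
    rw [← hl]
    exact hpath.isIndContained_cycleGraph (hl ▸ hlen) hxy hxz hxl

end Paths

/-! ### Walks confined to a set of vertices -/

section Reach

variable {X : Type*} {G : SimpleGraph X}

/-- The set of vertices with a neighbour in `S`; it may meet `S`. -/
def nbhd (G : SimpleGraph X) (S : Set X) : Set X := {z | ∃ y ∈ S, G.Adj y z}

/-- The layers grown from `S` through the sets `C 1, C 2, …`: layer `j + 1` consists of the
vertices of `C (j + 1)` with a neighbour in layer `j`. -/
def layer (G : SimpleGraph X) (C : ℕ → Set X) (S : Set X) : ℕ → Set X
  | 0 => S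
  | j + 1 => nbhd G (layer G C S j) ∩ C (j + 1)

/-- The vertices reached from `x` by walks of length between `1` and `n` with interior in `F`.
Neither `x` nor the vertex reached needs to lie in `F`. -/
def reach (G : SimpleGraph X) (F : Set X) (x : X) : ℕ → Set X
  | 0 => ∅
  | n + 1 => G.neighborSet x ∪ nbhd G (reach G F x n ∩ F)

variable {F F' S S' : Set X} {x y z : X} {m n : ℕ}

theorem nbhd_mono (h : S ⊆ S') : nbhd G S ⊆ nbhd G S' :=
  fun _ ⟨y, hy, hyz⟩ => ⟨y, h hy, hyz⟩

theorem reach_mono_set (h : F ⊆ F') (n : ℕ) : reach G F x n ⊆ reach G F' x n := by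
  induction n with
  | zero => exact subset_rfl
  | succ n ih => exact Set.union_subset_union_right _ (nbhd_mono (Set.inter_subset_inter ih h))

theorem reach_mono (h : m ≤ n) : reach G F x m ⊆ reach G F x n := by
  refine monotone_nat_of_le_succ (f := reach G F x) (fun i => ?_) h
  induction i with
  | zero => exact Set.empty_subset _
  | succ i ih => exact Set.union_subset_union_right _ (nbhd_mono (Set.inter_subset_inter_left _ ih))

theorem mem_reach_of_adj (h : G.Adj x z) (n : ℕ) : z ∈ reach G F x (n + 1) := Or.inl h

theorem mem_reach_succ (hy : y ∈ reach G F x n) (hyF : y ∈ F) (h : G.Adj y z) :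
    z ∈ reach G F x (n + 1) := Or.inr ⟨y, ⟨hy, hyF⟩, h⟩

theorem reach_one : reach G F x 1 = G.neighborSet x := by simp [reach, nbhd]

theorem reach_trans (hy : y ∈ reach G F x m) (hyF : y ∈ F) (n : ℕ) :
    reach G F y n ⊆ reach G F x (m + n) := by
  induction n with
  | zero => exact Set.empty_subset _
  | succ n ih =>
    rintro z (hyz | ⟨w, ⟨hw, hwF⟩, hwz⟩)
    · exact reach_mono (by omega) (mem_reach_succ hy hyF hyz)
    · exact mem_reach_succ (ih hw) hwF hwz

theorem mem_reach_symm (h : z ∈ reach G F x n) : x ∈ reach G F z n := by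
  induction n generalizing z with
  | zero => exact h
  | succ n ih =>
    rcases h with hxz | ⟨w, ⟨hw, hwF⟩, hwz⟩
    · exact mem_reach_of_adj hxz.symm n
    · exact reach_mono (by omega) (reach_trans (mem_reach_of_adj hwz.symm 0) hwF n (ih hw))

theorem reach_succ_subset_reach_inter (n : ℕ) :
    reach G F x (n + 1) ⊆ reach G (reach G F x n ∩ F) x (n + 1) := by
  induction n with
  | zero => rw [reach_one, reach_one]
  | succ n ih =>
    refine Set.union_subset_union_right _ (nbhd_mono fun w hw => ⟨?_, hw⟩)
    exact reach_mono_set (Set.inter_subset_inter_left _ (reach_mono n.le_succ)) _ (ih hw.1)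

theorem reach_diff_subset_nbhd (n : ℕ) :
    reach G F x (n + 2) \ reach G F x (n + 1) ⊆ nbhd G (reach G F x (n + 1) ∩ F) :=
  fun _ hz => hz.1.resolve_left fun h => hz.2 (Or.inl h)

theorem nbhd_layer_subset_reach {C : ℕ → Set X} (hC : ∀ i, 1 ≤ i → i ≤ n → C i ⊆ F) :
    nbhd G (layer G C {x} n) ⊆ reach G F x (n + 1) := by
  induction n with
  | zero =>
    rintro z ⟨_, rfl, hxz⟩
    exact mem_reach_of_adj hxz 0
  | succ n ih =>
    rintro z ⟨w, ⟨hw, hwC⟩, hwz⟩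
    exact mem_reach_succ (ih (fun i h₁ hi => hC i h₁ (by omega)) hw) (hC _ (by omega) le_rfl hwC)
      hwz

theorem exists_isInducedPath_of_mem_reach_diff (hz : z ∈ reach G F x (n + 1) \ reach G F x n) :
    ∃ l : List X, l.length = n ∧ IsInducedPath G (z :: (l ++ [x])) ∧
      ∀ c ∈ l, c ∈ reach G F x n ∩ F := by
  induction n generalizing z with
  | zero => exact ⟨[], rfl, .pair (reach_one.subset hz.1).symm, by simp⟩
  | succ n ih =>
    obtain ⟨hzx | ⟨w, ⟨hw, hwF⟩, hwz⟩, hz⟩ := hz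
    · exact (hz (mem_reach_of_adj hzx n)).elim
    obtain ⟨l, rfl, hl, hlF⟩ := ih ⟨hw, fun hw' => hz (mem_reach_succ hw' hwF hwz)⟩
    refine ⟨w :: l, rfl, .cons hwz.symm ?_ hl, ?_⟩
    · intro c hc hzc
      rcases List.mem_append.1 hc with hc | hc
      · exact hz (mem_reach_succ (hlF c hc).1 (hlF c hc).2 hzc.symm)
      · rw [List.mem_singleton.1 hc] at hzc
        exact hz (mem_reach_of_adj hzc.symm _)
    · rw [List.forall_mem_cons]
      exact ⟨⟨hw, hwF⟩, fun c hc => ⟨reach_mono (by omega) (hlF c hc).1, (hlF c hc).2⟩⟩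

end Reach

section Routes

variable {X : Type*} {G : SimpleGraph X} {B P P' R R' : Set X} {v x : X} {m m' : ℕ}

/-- Every edge from `B` to `P` extends to an induced path to `v` with `m` vertices between `P`
and `v`, all of them in `R` and none of them adjacent to a vertex of `B`. -/
def HasRoutes (G : SimpleGraph X) (B P R : Set X) (v : X) (m : ℕ) : Prop :=
  ∀ d ∈ B, ∀ w ∈ P, G.Adj d w → ∃ q : List X, q.length = m ∧
    IsInducedPath G (d :: w :: (q ++ [v])) ∧ ∀ c ∈ q, c ∈ R ∧ ∀ z ∈ B, ¬ G.Adj z c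

theorem hasRoutes_reach {F : Set X} {s : ℕ} (hB : ∀ z ∈ B, z ∉ reach G F v (s + 1)) :
    HasRoutes G B (reach G F v (s + 1) ∩ F) F v s := by
  rintro d hd w ⟨hw, hwF⟩ hdw
  have hfar : ∀ z ∈ B, ∀ c ∈ reach G F v s ∩ F, ¬ G.Adj z c := fun z hz c hc hzc =>
    hB z hz (mem_reach_succ hc.1 hc.2 hzc.symm)
  obtain ⟨q, hq, hpath, hqF⟩ := exists_isInducedPath_of_mem_reach_diff
    ⟨hw, fun hw' => hfar d hd w ⟨hw', hwF⟩ hdw⟩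
  refine ⟨q, hq, .cons hdw (fun c hc hdc => ?_) hpath,
    fun c hc => ⟨(hqF c hc).2, fun z hz => hfar z hz c (hqF c hc)⟩⟩
  rcases List.mem_append.1 hc with hc | hc
  · exact hfar d hd c (hqF c hc) hdc
  · rw [List.mem_singleton.1 hc] at hdc
    exact hB d hd (mem_reach_of_adj hdc.symm s)

theorem HasRoutes.append {l : List X} (h : HasRoutes G B P R x m) (hPR : P ⊆ R) (hRR' : R ⊆ R')
    (hl : IsInducedPath G (x :: (l ++ [v]))) (hlR' : ∀ c ∈ x :: l, c ∈ R')
    (hlB : ∀ c ∈ x :: (l ++ [v]), ∀ z ∈ B, ¬ G.Adj z c)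
    (hlR : ∀ c ∈ l ++ [v], ∀ z ∈ R, ¬ G.Adj z c) :
    HasRoutes G B P R' v (m + l.length + 1) := by
  intro d hd w hw hdw
  obtain ⟨q, rfl, hpath, hq⟩ := h d hd w hw hdw
  have hnadj : ∀ c ∈ d :: w :: q, ∀ e ∈ l ++ [v], ¬ G.Adj c e := by
    simp only [List.forall_mem_cons]
    exact ⟨fun e he => hlB e (List.mem_cons_of_mem _ he) d hd, fun e he => hlR e he w (hPR hw),
      fun c hc e he => hlR e he c (hq c hc).1⟩
  refine ⟨q ++ x :: l, by simp [add_assoc], ?_, fun c hc => ?_⟩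
  · simpa using IsInducedPath.append (l₁ := d :: w :: q) hpath hl hnadj
  · rcases List.mem_append.1 hc with hc | hc
    · exact ⟨hRR' (hq c hc).1, (hq c hc).2⟩
    · exact ⟨hlR' c hc, hlB c (List.mem_append_left [v] hc)⟩

theorem HasRoutes.isIndContained_cycleGraph_of_adj (h : HasRoutes G B P R v m)
    (h' : HasRoutes G B P' R' v m') (hPR : P ⊆ R) (hPR' : P' ⊆ R')
    (hRR' : ∀ c ∈ R, ∀ c' ∈ R', ¬ G.Adj c c') {y z w t : X} (hy : y ∈ B) (hz : z ∈ B)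
    (hyz : G.Adj y z) (hw : w ∈ P) (hwy : G.Adj w y) (hwz : ¬ G.Adj w z) (ht : t ∈ P')
    (htz : G.Adj t z) (hty : ¬ G.Adj t y) :
    (SimpleGraph.cycleGraph (m + m' + 5)).IsIndContained G := by
  obtain ⟨q, rfl, hpath, hq⟩ := h y hy w hw hwy.symm
  obtain ⟨r, rfl, hpath', hr⟩ := h' z hz t ht htz.symm
  have hcycle := isIndContained_cycleGraph_of_paths (a := w :: q) (b := t :: r) hpath hpath'
    (by simp only [List.length_cons]; omega) hyz.symm
    (List.forall_mem_cons.2 ⟨fun h => hwz h.symm, fun c hc => (hq c hc).2 z hz⟩)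
    (List.forall_mem_cons.2 ⟨fun h => hty h.symm, fun c hc => (hr c hc).2 y hy⟩) ?_
  · have hlength : q.length + r.length + 5 = (w :: q).length + (t :: r).length + 3 := by
      simp only [List.length_cons]; omega
    rwa [hlength]
  · have hqR : ∀ c ∈ w :: q, c ∈ R := List.forall_mem_cons.2 ⟨hPR hw, fun c hc => (hq c hc).1⟩
    have hrR' : ∀ c ∈ t :: r, c ∈ R' := List.forall_mem_cons.2 ⟨hPR' ht, fun c hc => (hr c hc).1⟩
    exact fun c hc d hd => hRR' c (hqR c hc) d (hrR' d hd)

theorem HasRoutes.isIndContained_cycleGraph_of_mem (h : HasRoutes G B P R v m)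
    (h' : HasRoutes G B P' R' v m') (hPR : P ⊆ R) (hPR' : P' ⊆ R')
    (hRR' : ∀ c ∈ R, ∀ c' ∈ R', ¬ G.Adj c c') {d : X} (hd : d ∈ B) (hdP : d ∈ nbhd G P)
    (hdP' : d ∈ nbhd G P') (hm : 1 ≤ m + m') :
    (SimpleGraph.cycleGraph (m + m' + 4)).IsIndContained G := by
  obtain ⟨w, hw, hwd⟩ := hdP
  obtain ⟨t, ht, htd⟩ := hdP'
  obtain ⟨q, rfl, hpath, hq⟩ := h d hd w hw hwd.symm
  obtain ⟨r, rfl, hpath', hr⟩ := h' d hd t ht htd.symm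
  have hqR : ∀ c ∈ w :: q, c ∈ R := List.forall_mem_cons.2 ⟨hPR hw, fun c hc => (hq c hc).1⟩
  obtain ⟨⟩ | ⟨-, -, htail⟩ := hpath'
  have hcycle := isIndContained_cycleGraph_of_paths (a := w :: q) (b := r) hpath htail
    (by simp only [List.length_cons]; omega) htd
    (fun c hc htc => hRR' c (hqR c hc) t (hPR' ht) htc.symm) (fun c hc => (hr c hc).2 d hd)
    (fun c hc e he => hRR' c (hqR c hc) e (hr e he).1)
  have hlength : q.length + (t :: r).length + 3 = (w :: q).length + r.length + 3 := by
    simp only [List.length_cons]; omega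
  rwa [← hlength] at hcycle

end Routes

/-! ### Limits of sparse graphs without pure pairs -/

/-- The combinatorial properties of an ultraproduct `G` of ever sparser graphs without large
anticomplete pairs. A set is internal if it is an ultraproduct of sets, and big if moreover its
factors contain a fixed positive proportion of the vertices. The property `exists_expanding` is
what the exponent of the smaller side of the pairs is used for: it concerns walks through `k + 1`
disjoint big sets. -/
structure SparseLimit {X : Type*} (G : SimpleGraph X) (k : ℕ) where
  Internal : Set X → Prop
  Big : Set X → Prop
  internal_of_big : ∀ {A}, Big A → Internal A
  internal_singleton : ∀ x, Internal {x}
  internal_inter : ∀ {A B}, Internal A → Internal B → Internal (A ∩ B)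
  internal_union : ∀ {A B}, Internal A → Internal B → Internal (A ∪ B)
  internal_diff : ∀ {A B}, Internal A → Internal B → Internal (A \ B)
  internal_nbhd : ∀ {A}, Internal A → Internal (nbhd G A)
  big_mono : ∀ {A B}, Big A → Internal B → A ⊆ B → Big B
  big_or_big_of_union : ∀ {A B}, Internal A → Internal B → Big (A ∪ B) → Big A ∨ Big B
  big_univ : Big Set.univ
  exists_big_disjoint : ∀ {A}, Big A → ∃ B ⊆ A, ∃ C ⊆ A, Big B ∧ Big C ∧ Disjoint B C
  not_big_neighborSet : ∀ x, ¬ Big (G.neighborSet x)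
  big_nbhd_inter : ∀ {A B}, Big A → Big B → Big (nbhd G A ∩ B)
  exists_halving : ∀ {A B}, Internal A → Internal B → Big (nbhd G A ∩ B) →
    ∃ A' ⊆ A, Internal A' ∧ Big (nbhd G A' ∩ B) ∧ Big (B \ nbhd G A')
  exists_expanding : ∀ C : ℕ → Set X, (∀ i ≤ k, Big (C i)) → (Set.Iic k).PairwiseDisjoint C →
    ∃ x ∈ C 0, ∀ D, Big D → Big (nbhd G (layer G C {x} k) ∩ D)

namespace SparseLimit

variable {X : Type*} {G : SimpleGraph X} {k : ℕ} (L : SparseLimit G k) {A B D F T W : Set X}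
  {x : X} {m n : ℕ}

include L

theorem internal_neighborSet (x : X) : L.Internal (G.neighborSet x) := by
  have hx : nbhd G {x} = G.neighborSet x := by ext z; simp [nbhd]
  exact hx ▸ L.internal_nbhd (L.internal_singleton x)

theorem not_big_of_subset_neighborSet (h : A ⊆ G.neighborSet x) : ¬ L.Big A :=
  fun hA => L.not_big_neighborSet x (L.big_mono hA (L.internal_neighborSet x) h)

theorem big_inter_or_big_diff (hA : L.Big A) (hB : L.Internal B) :
    L.Big (A ∩ B) ∨ L.Big (A \ B) := by
  have hA' := L.internal_of_big hA
  refine L.big_or_big_of_union (L.internal_inter hA' hB) (L.internal_diff hA' hB) ?_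
  rwa [Set.inter_union_sdiff]

theorem internal_reach (hF : L.Internal F) (x : X) (n : ℕ) : L.Internal (reach G F x n) := by
  induction n with
  | zero =>
    have huniv := L.internal_of_big L.big_univ
    simpa [reach] using L.internal_diff huniv huniv
  | succ n ih =>
    exact L.internal_union (L.internal_neighborSet x) (L.internal_nbhd (L.internal_inter ih hF))

theorem big_reach_inter_mono {F' : Set X} {y : X} {n' : ℕ} (hF' : L.Internal F')
    (hD : L.Internal D) (h : reach G F x n ⊆ reach G F' y n') (hbig : L.Big (reach G F x n ∩ D)) :
    L.Big (reach G F' y n' ∩ D) :=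
  L.big_mono hbig (L.internal_inter (L.internal_reach hF' y n') hD)
    (Set.inter_subset_inter_left _ h)

theorem exists_big_diff_neighborSet (hA : L.Big A) (l : List X) :
    ∃ B ⊆ A, L.Big B ∧ ∀ c ∈ l, ∀ z ∈ B, ¬ G.Adj z c := by
  induction l with
  | nil => exact ⟨A, subset_rfl, hA, by simp⟩
  | cons a l ih =>
    obtain ⟨B, hBA, hB, hBl⟩ := ih
    refine ⟨B \ G.neighborSet a, Set.sdiff_subset.trans hBA, ?_, List.forall_mem_cons.2
      ⟨fun z hz hza => hz.2 hza.symm, fun c hc z hz => hBl c hc z hz.1⟩⟩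
    exact (L.big_inter_or_big_diff hB (L.internal_neighborSet a)).resolve_left
      (L.not_big_of_subset_neighborSet Set.inter_subset_right)

theorem not_big_reach_one_inter : ¬ L.Big (reach G F x 1 ∩ D) :=
  L.not_big_of_subset_neighborSet (Set.inter_subset_left.trans reach_one.subset)

theorem exists_big_reach_diff (hF : L.Internal F) (hD : L.Internal D)
    (hm : ¬ L.Big (reach G F x (m + 1) ∩ D)) (hn : L.Big (reach G F x n ∩ D)) :
    ∃ j, m ≤ j ∧ j + 1 < n ∧ L.Big ((reach G F x (j + 2) \ reach G F x (j + 1)) ∩ D) := by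
  obtain ⟨i, hi, hi'⟩ := Nat.exists_not_and_succ_of_not_zero_of_exists
    (p := fun i => L.Big (reach G F x (m + 1 + i) ∩ D)) hm
    ⟨n, L.big_reach_inter_mono hF hD (reach_mono (by omega)) hn⟩
  have hlt : m + i + 1 < n := by
    by_contra! hle
    exact hi (L.big_reach_inter_mono hF hD (reach_mono (by omega)) hn)
  refine ⟨m + i, by omega, hlt, ?_⟩
  rw [show m + 1 + i = m + i + 1 by omega] at hi
  rw [show m + 1 + (i + 1) = m + i + 2 by omega] at hi'
  have hreach := L.internal_reach hF x
  rw [← Set.inter_sdiff_right_comm]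
  refine (L.big_inter_or_big_diff hi' (hreach (m + i + 1))).resolve_left fun hbig => hi ?_
  exact L.big_mono hbig (L.internal_inter (hreach _) hD) fun z hz => ⟨hz.2, hz.1.2⟩

theorem exists_halving_of_subset_nbhd (hA : L.Internal A) (hB : L.Big B) (hAB : B ⊆ nbhd G A) :
    ∃ A' ⊆ A, L.Internal A' ∧ L.Big (nbhd G A' ∩ B) ∧ L.Big (B \ nbhd G A') :=
  L.exists_halving hA (L.internal_of_big hB) (by rwa [Set.inter_eq_right.2 hAB])

theorem exists_pairwiseDisjoint (hA : L.Big A) (hF : L.Big F) (hAF : Disjoint A F) (n : ℕ) :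
    ∃ C : ℕ → Set X, C 0 = A ∧ (∀ i, 1 ≤ i → i ≤ n → C i ⊆ F) ∧ (∀ i ≤ n, L.Big (C i)) ∧
      (Set.Iic n).PairwiseDisjoint C := by
  induction n generalizing A F with
  | zero =>
    refine ⟨fun _ => A, rfl, fun i hi hi' => by omega, fun _ _ => hA, fun i hi j hj hij => ?_⟩
    rw [Set.mem_Iic] at hi hj
    omega
  | succ n ih =>
    obtain ⟨A', hA'F, F', hF'F, hA', hF', hdisj⟩ := L.exists_big_disjoint hF
    obtain ⟨C, hC₀, hCF', hC, hCdisj⟩ := ih hA' hF' hdisj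
    have hCF : ∀ i ≤ n, C i ⊆ F := by
      rintro (_ | i) hi
      · exact hC₀ ▸ hA'F
      · exact (hCF' _ (by omega) hi).trans hF'F
    refine ⟨fun i => i.casesOn A C, rfl, ?_, ?_, ?_⟩
    · rintro (_ | i) hi hi'
      · omega
      · exact hCF i (by omega)
    · rintro (_ | i) hi
      · exact hA
      · exact hC i (by omega)
    · rintro (_ | i) hi (_ | j) hj hij
      · exact (hij rfl).elim
      · exact hAF.mono_right (hCF j (Nat.succ_le_succ_iff.1 hj))
      · exact (hAF.mono_right (hCF i (Nat.succ_le_succ_iff.1 hi))).symm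
      · exact hCdisj (Nat.succ_le_succ_iff.1 hi) (Nat.succ_le_succ_iff.1 hj)
          fun h => hij (congrArg _ h)

theorem exists_forall_big_reach (hA : L.Big A) (hF : L.Big F) (hAF : Disjoint A F) :
    ∃ y ∈ A, ∀ D, L.Big D → L.Big (reach G F y (k + 1) ∩ D) := by
  obtain ⟨C, rfl, hCF, hC, hCdisj⟩ := L.exists_pairwiseDisjoint hA hF hAF k
  obtain ⟨y, hy, hexp⟩ := L.exists_expanding C hC hCdisj
  refine ⟨y, hy, fun D hD => L.big_mono (hexp D hD) ?_
    (Set.inter_subset_inter_left _ (nbhd_layer_subset_reach hCF))⟩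
  exact L.internal_inter (L.internal_reach (L.internal_of_big hF) y _) (L.internal_of_big hD)

theorem exists_private_nbr_seq (hA : L.Internal A) (hB : L.Big B) (hAB : B ⊆ nbhd G A) (n : ℕ) :
    ∃ C : ℕ → Set X, (∀ i < n, L.Big (C i) ∧ C i ⊆ B) ∧
      ∀ i j, i < j → j < n → ∀ y ∈ C i, ∀ x ∈ C j, ∃ w ∈ A, G.Adj w y ∧ ¬ G.Adj w x := by
  induction n generalizing B with
  | zero => exact ⟨fun _ => ∅, by simp, by simp⟩
  | succ n ih =>
    obtain ⟨A', hA'A, -, hin, hout⟩ := L.exists_halving_of_subset_nbhd hA hB hAB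
    obtain ⟨C, hC, hCsep⟩ := ih hout (Set.sdiff_subset.trans hAB)
    refine ⟨fun i => i.casesOn (nbhd G A' ∩ B) C, ?_, ?_⟩
    · rintro (_ | i) hi
      · exact ⟨hin, Set.inter_subset_right⟩
      · exact ⟨(hC i (by omega)).1, (hC i (by omega)).2.trans Set.sdiff_subset⟩
    · rintro (_ | i) (_ | j) hij hj y hy x hx
      · omega
      · obtain ⟨w, hw, hwy⟩ := hy.1
        exact ⟨w, hA'A hw, hwy, fun hwx => ((hC j (by omega)).2 hx).2 ⟨w, hw, hwx⟩⟩
      · omega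
      · exact hCsep i j (by omega) (by omega) y hy x hx

/- If no edge is as required, then along a sequence of sets with private neighbours in `A` every
neighbour `t ∈ T` of a vertex remains a neighbour of all vertices on the walks going backwards from
it, so that an expanding vertex reaches only neighbours of `t`. -/
theorem exists_adj_private_nbrs (hA : L.Internal A) (hB : L.Big B) (hAB : B ⊆ nbhd G A)
    (hTB : B ⊆ nbhd G T) :
    ∃ y ∈ B, ∃ z ∈ B, G.Adj y z ∧ (∃ w ∈ A, G.Adj w y ∧ ¬ G.Adj w z) ∧
      ∃ t ∈ T, G.Adj t z ∧ ¬ G.Adj t y := by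
  by_contra! hcon
  obtain ⟨C, hC, hCsep⟩ := L.exists_private_nbr_seq hA hB hAB (k + 2)
  have hpropagate : ∀ i j, i < j → j < k + 2 → ∀ y ∈ C i, ∀ z ∈ C j, G.Adj z y →
      ∀ t ∈ T, G.Adj t z → G.Adj t y := fun i j hij hj y hy z hz hzy =>
    hcon y ((hC i (by omega)).2 hy) z ((hC j hj).2 hz) hzy.symm (hCsep i j hij hj y hy z hz)
  have hdisj : ∀ i j, i < j → j < k + 2 → Disjoint (C i) (C j) := fun i j hij hj =>
    Set.disjoint_left.2 fun z hi hj' =>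
      let ⟨_, _, hadj, hnadj⟩ := hCsep i j hij hj z hi z hj'
      hnadj hadj
  obtain ⟨x, hx, hexp⟩ := L.exists_expanding (fun i => C (k + 1 - i))
    (fun i _ => (hC _ (by omega)).1) (by
      intro i hi j hj hij
      rw [Set.mem_Iic] at hi hj
      rcases hij.lt_or_gt with hlt | hlt
      · exact (hdisj _ _ (by omega) (by omega)).symm
      · exact hdisj _ _ (by omega) (by omega))
  obtain ⟨t, ht, htx⟩ := hTB ((hC (k + 1) (by omega)).2 hx)
  have hlayer : ∀ j ≤ k, ∀ z ∈ layer G (fun i => C (k + 1 - i)) {x} j,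
      z ∈ C (k + 1 - j) ∧ G.Adj t z := by
    intro j
    induction j with
    | zero =>
      rintro - z rfl
      exact ⟨hx, htx⟩
    | succ j ih =>
      rintro hj z ⟨⟨u, hu, huz⟩, hz⟩
      obtain ⟨huC, htu⟩ := ih (by omega) u hu
      exact ⟨hz, hpropagate _ _ (by omega) (by omega) z hz u huC huz t ht htu⟩
  refine L.not_big_of_subset_neighborSet (x := t) ?_ (hexp (C 0) (hC 0 (by omega)).1)
  rintro z ⟨⟨u, hu, huz⟩, hz⟩
  obtain ⟨huC, htu⟩ := hlayer k le_rfl u hu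
  exact hpropagate _ _ (by omega) (by omega) z hz u huC huz t ht htu

theorem exists_stable_scale (hD : L.Big D) (hF : L.Big F) :
    ∃ n < k, ∃ W ⊆ F, L.Big W ∧ (∀ x ∈ W, ¬ L.Big (reach G W x (n + 1) ∩ D)) ∧
      ∀ W' ⊆ W, L.Big W' → ∃ y ∈ W', L.Big (reach G W' y (n + 2) ∩ D) := by
  let Unreached (n : ℕ) : Prop :=
    ∃ W ⊆ F, L.Big W ∧ ∀ x ∈ W, ¬ L.Big (reach G W x (n + 1) ∩ D)
  have hzero : Unreached 0 := ⟨F, subset_rfl, hF, fun x _ => L.not_big_reach_one_inter⟩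
  have hlarge : ∀ n, k ≤ n → ¬ Unreached n := by
    rintro n hn ⟨W, -, hW, hWD⟩
    obtain ⟨A, hAW, B, hBW, hA, hB, hdisj⟩ := L.exists_big_disjoint hW
    obtain ⟨y, hy, hyD⟩ := L.exists_forall_big_reach hA hB hdisj
    exact hWD y (hAW hy) (L.big_reach_inter_mono (L.internal_of_big hW) (L.internal_of_big hD)
      ((reach_mono_set hBW _).trans (reach_mono (by omega))) (hyD D hD))
  obtain ⟨n, hn, hn'⟩ := Nat.exists_not_and_succ_of_not_zero_of_exists
    (p := fun n => ¬ Unreached n) (not_not.2 hzero) ⟨k, hlarge k le_rfl⟩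
  obtain ⟨W, hWF, hW, hWD⟩ := not_not.1 hn
  refine ⟨n, not_le.1 fun hkn => hlarge n hkn (not_not.1 hn), W, hWF, hW, hWD,
    fun W' hW'W hW' => ?_⟩
  by_contra! hcon
  exact hn' ⟨W', hW'W.trans hWF, hW', hcon⟩

end SparseLimit

/-! ### Induced cycles in limits -/

namespace SparseLimit

section PathBundle

variable {X : Type*} {G : SimpleGraph X} {k : ℕ} {L : SparseLimit G k} {R W E F D T : Set X}
  {v : X} {p n s : ℕ}

/-- Big sets `E` and `F` inside `W` such that every vertex of `E` is joined to `v` by an induced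
path with `p` interior vertices, all of them in `R` and none of them adjacent to a vertex of `F`.
The set `F` is the room left for prolonging the paths. -/
structure IsPathBundle (L : SparseLimit G k) (R W : Set X) (v : X) (p : ℕ) (E F : Set X) :
    Prop where
  big_left : L.Big E
  big_right : L.Big F
  left_subset : E ⊆ W
  right_subset : F ⊆ W
  exists_path : ∀ y ∈ E, ∃ l : List X, l.length = p ∧ IsInducedPath G (y :: (l ++ [v])) ∧
    ∀ c ∈ l, c ∈ R ∧ ∀ z ∈ F, ¬ G.Adj z c

theorem IsPathBundle.exists_succ (h : L.IsPathBundle R W v p E F) (hWR : W ⊆ R)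
    (hv : ∀ z ∈ W, ¬ G.Adj z v) : ∃ E' F', L.IsPathBundle R W v (p + 1) E' F' := by
  obtain ⟨A, hAE, -, hin, hout⟩ := L.exists_halving (L.internal_of_big h.big_left)
    (L.internal_of_big h.big_right) (L.big_nbhd_inter h.big_left h.big_right)
  refine ⟨_, _, hin, hout, Set.inter_subset_right.trans h.right_subset,
    Set.sdiff_subset.trans h.right_subset, ?_⟩
  rintro y ⟨⟨z, hzA, hzy⟩, hyF⟩
  obtain ⟨l, rfl, hl, hlRF⟩ := h.exists_path z (hAE hzA)
  refine ⟨z :: l, rfl, .cons hzy.symm (fun c hc hyc => ?_) hl, List.forall_mem_cons.2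
    ⟨⟨hWR (h.left_subset (hAE hzA)), fun u hu huz => hu.2 ⟨z, hzA, huz.symm⟩⟩,
      fun c hc => ⟨(hlRF c hc).1, fun u hu => (hlRF c hc).2 u hu.1⟩⟩⟩
  rcases List.mem_append.1 hc with hc | hc
  · exact (hlRF c hc).2 y hyF hyc
  · exact hv y (h.right_subset hyF) (List.mem_singleton.1 hc ▸ hyc)

theorem IsPathBundle.exists_add (h : L.IsPathBundle R W v p E F) (hWR : W ⊆ R)
    (hv : ∀ z ∈ W, ¬ G.Adj z v) (e : ℕ) : ∃ E' F', L.IsPathBundle R W v (p + e) E' F' := by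
  induction e with
  | zero => exact ⟨E, F, h⟩
  | succ e ih =>
    obtain ⟨E', F', h'⟩ := ih
    exact h'.exists_succ hWR hv

theorem IsPathBundle.exists_big_reach_diff (h : L.IsPathBundle R W v p E F) (hW : L.Internal W)
    (hD : L.Internal D) (hn : ∀ x ∈ W, ¬ L.Big (reach G W x (n + 1) ∩ D))
    (hn' : ∀ W' ⊆ W, L.Big W' → ∃ y ∈ W', L.Big (reach G W' y (n + 2) ∩ D)) :
    ∃ x ∈ E, ∃ i, (i = n ∨ i = n + 1) ∧
      L.Big ((reach G F x (i + 2) \ reach G F x (i + 1)) ∩ D) := by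
  have hF := L.internal_of_big h.big_right
  obtain ⟨y, ⟨⟨x, hxE, hxy⟩, hyF⟩, hy⟩ := hn' _ (Set.inter_subset_right.trans h.right_subset)
    (L.big_nbhd_inter h.big_left h.big_right)
  have hreached : L.Big (reach G F x (1 + (n + 2)) ∩ D) :=
    L.big_reach_inter_mono hF hD ((reach_mono_set Set.inter_subset_right _).trans
      (reach_trans (mem_reach_of_adj hxy 0) hyF _)) hy
  have hunreached : ¬ L.Big (reach G F x (n + 1) ∩ D) := fun hbig =>
    hn x (h.left_subset hxE)
      (L.big_reach_inter_mono hW hD (reach_mono_set h.right_subset _) hbig)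
  obtain ⟨i, hni, hin, hbig⟩ := L.exists_big_reach_diff hF hD hunreached hreached
  exact ⟨x, hxE, i, by omega, hbig⟩

theorem IsPathBundle.exists_hasRoutes (h : L.IsPathBundle R W v p E F) (hWR : W ⊆ R)
    (hv : ∀ z ∈ W, ¬ G.Adj z v) {x : X} (hx : x ∈ E) {i : ℕ}
    (hbig : L.Big ((reach G F x (i + 2) \ reach G F x (i + 1)) ∩ D)) :
    ∃ B ⊆ D, L.Big B ∧ B ⊆ nbhd G (reach G F x (i + 1) ∩ F) ∧
      HasRoutes G B (reach G F x (i + 1) ∩ F) R v (i + p + 1) := by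
  obtain ⟨l, rfl, hl, hlRF⟩ := h.exists_path x hx
  obtain ⟨B, hBsub, hB, hBl⟩ := L.exists_big_diff_neighborSet hbig (x :: (l ++ [v]))
  refine ⟨B, hBsub.trans Set.inter_subset_right, hB,
    fun z hz => reach_diff_subset_nbhd i (hBsub hz).1, ?_⟩
  refine (hasRoutes_reach fun z hz => (hBsub hz).1.2).append Set.inter_subset_right
    (h.right_subset.trans hWR) hl
    (List.forall_mem_cons.2 ⟨hWR (h.left_subset hx), fun c hc => (hlRF c hc).1⟩) hBl ?_
  intro c hc z hz
  rcases List.mem_append.1 hc with hc | hc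
  · exact (hlRF c hc).2 z hz
  · exact List.mem_singleton.1 hc ▸ hv z (h.right_subset hz)

/- The vertex `x` of `E` first sees `D` at distance `n + 1` or `n + 2`. In the former case the cycle
is closed through an edge of `D`, in the latter through a vertex of `D`, so that the length is the
same. -/
theorem IsPathBundle.isIndContained_cycleGraph (h : L.IsPathBundle R W v p E F) (hWR : W ⊆ R)
    (hv : ∀ z ∈ W, ¬ G.Adj z v) (hRT : ∀ c ∈ R, ∀ t ∈ T, ¬ G.Adj c t) (hW : L.Internal W)
    (hD : L.Big D) (hDT : D ⊆ reach G T v (s + 2) \ reach G T v (s + 1))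
    (hn : ∀ x ∈ W, ¬ L.Big (reach G W x (n + 1) ∩ D))
    (hn' : ∀ W' ⊆ W, L.Big W' → ∃ y ∈ W', L.Big (reach G W' y (n + 2) ∩ D)) :
    (SimpleGraph.cycleGraph (n + p + s + 6)).IsIndContained G := by
  obtain ⟨x, hxE, i, hi, hbig⟩ := h.exists_big_reach_diff hW (L.internal_of_big hD) hn hn'
  obtain ⟨B, hBD, hB, hBF, hroutesF⟩ := h.exists_hasRoutes hWR hv hxE hbig
  have hBT : B ⊆ nbhd G (reach G T v (s + 1) ∩ T) := fun z hz =>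
    reach_diff_subset_nbhd s (hDT (hBD hz))
  have hroutesT : HasRoutes G B (reach G T v (s + 1) ∩ T) T v s :=
    hasRoutes_reach fun z hz => (hDT (hBD hz)).2
  have hFR : reach G F x (i + 1) ∩ F ⊆ R :=
    Set.inter_subset_right.trans (h.right_subset.trans hWR)
  have hFint := L.internal_of_big h.big_right
  rcases hi with rfl | rfl
  · obtain ⟨y, hy, z, hz, hyz, ⟨w, hw, hwy, hwz⟩, t, ht, htz, hty⟩ := L.exists_adj_private_nbrs
      (L.internal_inter (L.internal_reach hFint x _) hFint) hB hBF hBT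
    have hcycle := hroutesF.isIndContained_cycleGraph_of_adj hroutesT hFR Set.inter_subset_right
      hRT hy hz hyz hw hwy hwz ht htz hty
    rwa [show i + p + s + 6 = i + p + 1 + s + 5 by omega]
  · obtain ⟨d, hd⟩ : B.Nonempty := by
      rw [Set.nonempty_iff_ne_empty]
      rintro rfl
      exact L.not_big_of_subset_neighborSet (Set.empty_subset (G.neighborSet x)) hB
    have hcycle := hroutesF.isIndContained_cycleGraph_of_mem hroutesT hFR Set.inter_subset_right
      hRT hd (hBF hd) (hBT hd) (by omega)
    rwa [show n + p + s + 6 = n + 1 + p + 1 + s + 4 by omega]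

end PathBundle

variable {X : Type*} {G : SimpleGraph X} {k : ℕ} (L : SparseLimit G k) {A R W : Set X} {v y : X}

include L

theorem exists_apex : ∃ M F T : Set X, L.Big M ∧ L.Big F ∧ L.Internal T ∧
    (∀ z ∈ F, ∀ t ∈ T, ¬ G.Adj z t) ∧ ∀ v ∈ M, M ⊆ reach G T v (2 * (k + 1)) := by
  obtain ⟨V₀, -, V₁₂, -, hV₀, hV₁₂, hdisj⟩ := L.exists_big_disjoint L.big_univ
  obtain ⟨V₁, hV₁V, V₂, -, hV₁, hV₂, -⟩ := L.exists_big_disjoint hV₁₂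
  obtain ⟨h, -, hreach⟩ := L.exists_forall_big_reach hV₀ hV₁ (hdisj.mono_right hV₁V)
  have hV₁int := L.internal_of_big hV₁
  obtain ⟨m, -, hmk, hlevel⟩ := L.exists_big_reach_diff hV₁int (L.internal_of_big hV₂)
    (m := 0) L.not_big_reach_one_inter (hreach _ hV₂)
  obtain ⟨A, hA, hAint, hnear, hfar⟩ := L.exists_halving_of_subset_nbhd
    (L.internal_inter (L.internal_reach hV₁int h (m + 1)) hV₁int) hlevel
    fun z hz => reach_diff_subset_nbhd m hz.1
  let T := {h} ∪ (reach G V₁ h m ∩ V₁ ∪ A)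
  have hhT : h ∈ T := Or.inl rfl
  have hAT : A ⊆ T := fun z hz => Or.inr (Or.inr hz)
  have hA_reach : A ⊆ reach G T h (m + 1) := fun a ha =>
    reach_mono_set (fun z hz => Or.inr (Or.inl hz)) _ (reach_succ_subset_reach_inter m (hA ha).1)
  have hnear_reach : nbhd G A ⊆ reach G T h (m + 2) := fun z ⟨a, ha, haz⟩ =>
    mem_reach_succ (hA_reach ha) (hAT ha) haz
  refine ⟨_, _, T, hnear, hfar, ?_, ?_, ?_⟩
  · exact L.internal_union (L.internal_singleton h) (L.internal_union
      (L.internal_inter (L.internal_reach hV₁int h m) hV₁int) hAint)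
  · rintro z ⟨⟨⟨-, hz⟩, -⟩, hzA⟩ t (rfl | ht | ht) hzt
    · exact hz (mem_reach_of_adj hzt.symm m)
    · exact hz (mem_reach_succ ht.1 ht.2 hzt.symm)
    · exact hzA ⟨t, ht, hzt.symm⟩
  · rintro v ⟨hv, -⟩ d ⟨hd, -⟩
    exact reach_mono (by omega)
      (reach_trans (mem_reach_symm (hnear_reach hv)) hhT _ (hnear_reach hd))

theorem exists_isPathBundle (hA : L.Big A) (hW : L.Big W) (hAR : A ⊆ R) (hyR : y ∈ R)
    (hyv : G.Adj y v) (hreach : L.Big (reach G A y (k + 1) ∩ W)) (hvA : ∀ z ∈ A, ¬ G.Adj z v)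
    (hvW : ∀ z ∈ W, ¬ G.Adj z v) :
    ∃ p ≤ k + 1, ∃ E F, L.IsPathBundle R W v p E F := by
  have hAint := L.internal_of_big hA
  obtain ⟨g, -, hgk, hlevel⟩ := L.exists_big_reach_diff hAint (L.internal_of_big hW)
    (m := 0) L.not_big_reach_one_inter hreach
  obtain ⟨B, hB, -, hE, hF⟩ := L.exists_halving_of_subset_nbhd
    (L.internal_inter (L.internal_reach hAint y (g + 1)) hAint) hlevel
    fun z hz => reach_diff_subset_nbhd g hz.1
  refine ⟨g + 2, by omega, _, _, hE, hF, Set.inter_subset_right.trans Set.inter_subset_right,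
    Set.sdiff_subset.trans Set.inter_subset_right, ?_⟩
  set S := (reach G A y (g + 2) \ reach G A y (g + 1)) ∩ W
  have hroutes : HasRoutes G S (reach G A y (g + 1) ∩ A) R v (g + 1) := by
    refine (hasRoutes_reach fun z hz => hz.1.2).append (l := []) Set.inter_subset_right hAR
      (.pair hyv) (by simpa using hyR) ?_ (by simpa using hvA)
    simp only [List.nil_append, List.forall_mem_cons]
    exact ⟨fun z hz hzy => hz.1.2 (mem_reach_of_adj hzy.symm g), fun z hz => hvW z hz.2, by simp⟩
  rintro z ⟨⟨b, hb, hbz⟩, hzS⟩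
  obtain ⟨q, hq, hpath, hqRS⟩ := hroutes z hzS b (hB hb) hbz.symm
  refine ⟨b :: q, by simp only [List.length_cons, hq], hpath, List.forall_mem_cons.2
    ⟨⟨hAR (hB hb).2, fun u hu hub => hu.2 ⟨b, hb, hub.symm⟩⟩,
      fun c hc => ⟨(hqRS c hc).1, fun u hu => (hqRS c hc).2 u hu.1⟩⟩⟩

theorem isIndContained_cycleGraph {ℓ : ℕ} (hℓ : 4 * (k + 1) + 5 ≤ ℓ) :
    (SimpleGraph.cycleGraph ℓ).IsIndContained G := by
  obtain ⟨M, F, T, hM, hF, hT, hFT, hreach⟩ := L.exists_apex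
  obtain ⟨M₁, hM₁M, M₂, hM₂M, hM₁, hM₂, -⟩ := L.exists_big_disjoint hM
  obtain ⟨N, hN, -, hnear, hfar⟩ := L.exists_halving (L.internal_of_big hM₁)
    (L.internal_of_big hF) (L.big_nbhd_inter hM₁ hF)
  obtain ⟨A, hA_far, Z, hZ_far, hA, hZ, -⟩ := L.exists_big_disjoint hfar
  obtain ⟨y, ⟨⟨v, hv, hvy⟩, hyF⟩, hy⟩ := L.exists_forall_big_reach hnear hA
    (Set.disjoint_left.2 fun z hz hzA => (hA_far hzA).2 hz.1)
  have hv_far : ∀ z ∈ F \ nbhd G N, ¬ G.Adj z v := fun z hz hzv => hz.2 ⟨v, hv, hzv.symm⟩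
  obtain ⟨s, -, hs, hD⟩ := L.exists_big_reach_diff (n := 2 * (k + 1)) (x := v) (m := 0) hT
    (L.internal_of_big hM₂) L.not_big_reach_one_inter
    (by rwa [Set.inter_eq_right.2 (hM₂M.trans (hreach v (hM₁M (hN hv))))])
  obtain ⟨n, hn, W, hWZ, hW, hWn, hWn'⟩ := L.exists_stable_scale hD hZ
  have hWF : W ⊆ F := hWZ.trans (hZ_far.trans Set.sdiff_subset)
  have hWv : ∀ z ∈ W, ¬ G.Adj z v := fun z hz => hv_far z (hZ_far (hWZ hz))
  obtain ⟨p, hp, E, F', hbundle⟩ := L.exists_isPathBundle hA hW (hA_far.trans Set.sdiff_subset)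
    hyF hvy.symm (hy W hW) (fun z hz => hv_far z (hA_far hz)) hWv
  obtain ⟨E', F'', hbundle'⟩ := hbundle.exists_add hWF hWv (ℓ - (n + p + s + 6))
  have hcycle := hbundle'.isIndContained_cycleGraph hWF hWv hFT (L.internal_of_big hW) hD
    Set.inter_subset_left hWn hWn'
  rwa [show n + (p + (ℓ - (n + p + s + 6))) + s + 6 = ℓ by omega] at hcycle

end SparseLimit

/-! ### Expansion in finite graphs without large anticomplete pairs -/

section Expansion

variable {V : Type*} {G : SimpleGraph V} {A B C C' S Y : Set V} {a b α m r d N ε θ : ℝ} {t : ℕ}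

/-- There is an edge between any two disjoint sets of at least `a` and at least `b` vertices. -/
def NoAnticompletePair (G : SimpleGraph V) (a b : ℝ) : Prop :=
  ∀ A B : Set V, Disjoint A B → a ≤ A.ncard → b ≤ B.ncard → ∃ x ∈ A, ∃ y ∈ B, G.Adj x y

theorem nbhd_union : nbhd G (S ∪ Y) = nbhd G S ∪ nbhd G Y := by
  ext z
  simp only [nbhd, Set.mem_union, Set.mem_ofPred_eq, or_and_right, exists_or]

theorem layer_succ_eq (C : ℕ → Set V) (S : Set V) (j : ℕ) :
    layer G C S (j + 1) = layer G (fun i => C (i + 1)) (nbhd G S ∩ C 1) j := by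
  induction j with
  | zero => rfl
  | succ j ih => rw [layer, ih]; rfl

theorem layer_mono {C : ℕ → Set V} (h : S ⊆ Y) (j : ℕ) : layer G C S j ⊆ layer G C Y j := by
  induction j with
  | zero => exact h
  | succ j ih => exact Set.inter_subset_inter_left _ (nbhd_mono ih)

theorem NoAnticompletePair.ncard_diff_nbhd_lt (h : NoAnticompletePair G a b) (hAB : Disjoint A B)
    (hA : b ≤ A.ncard) : ((B \ nbhd G A).ncard : ℝ) < a := by
  by_contra! hlt
  obtain ⟨x, hx, y, hy, hxy⟩ := h (B \ nbhd G A) A (hAB.symm.mono_left Set.sdiff_subset) hlt hA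
  exact hx.2 ⟨y, hy, hxy.symm⟩

theorem NoAnticompletePair.adj_of_ne (h : NoAnticompletePair G a b) (ha : a ≤ 1) (hb : b ≤ 1)
    {x y : V} (hxy : x ≠ y) : G.Adj x y := by
  simpa using h {x} {y} (by simpa using hxy) (by simpa using ha) (by simpa using hb)

variable [Finite V]

theorem ncard_inter_add_ncard_diff (A B : Set V) :
    ((A ∩ B).ncard : ℝ) + (B \ A).ncard = B.ncard := by
  rw [Set.inter_comm]
  exact_mod_cast Set.ncard_inter_add_ncard_sdiff_eq_ncard B A

theorem NoAnticompletePair.le_ncard_nbhd_inter (h : NoAnticompletePair G a b) (hb : 0 ≤ b)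
    (hA : b ≤ A.ncard) : (B.ncard : ℝ) - a - b - 1 ≤ (nbhd G A ∩ B).ncard := by
  obtain ⟨S, hSA, hS⟩ := Set.exists_subset_card_eq (s := A) (n := ⌈b⌉₊) (Nat.ceil_le.2 hA)
  have hmissed := h.ncard_diff_nbhd_lt (A := S) (B := B \ S) Set.disjoint_sdiff_right
    (by rw [hS]; exact Nat.le_ceil b)
  have hS_lt : (S.ncard : ℝ) < b + 1 := by rw [hS]; exact Nat.ceil_lt_add_one hb
  have hcover : B ⊆ (nbhd G A ∩ B) ∪ ((B \ S) \ nbhd G S) ∪ S := by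
    intro z hz
    by_cases hzS : z ∈ S
    · exact Or.inr hzS
    by_cases hzn : z ∈ nbhd G S
    · exact Or.inl (Or.inl ⟨nbhd_mono hSA hzn, hz⟩)
    · exact Or.inl (Or.inr ⟨⟨hz, hzS⟩, hzn⟩)
  have hcard : (B.ncard : ℝ) ≤ (nbhd G A ∩ B).ncard + ((B \ S) \ nbhd G S).ncard + S.ncard := by
    exact_mod_cast (Set.ncard_le_ncard hcover).trans ((Set.ncard_union_le _ _).trans
      (Nat.add_le_add_right (Set.ncard_union_le _ _) _))
  linarith

theorem exists_subset_ncard_nbhd_inter_lt (hd : ∀ x, ((G.neighborSet x).ncard : ℝ) ≤ d)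
    (hr : 0 < r) (hA : r ≤ (nbhd G A ∩ B).ncard) :
    ∃ S ⊆ A, r ≤ (nbhd G S ∩ B).ncard ∧ ((nbhd G S ∩ B).ncard : ℝ) < r + d := by
  obtain ⟨S, ⟨hSA, hS⟩, hmin⟩ := Set.Finite.exists_minimalFor (fun S : Set V => S.ncard)
    {S | S ⊆ A ∧ r ≤ (nbhd G S ∩ B).ncard} (Set.toFinite _) ⟨A, subset_rfl, hA⟩
  refine ⟨S, hSA, hS, ?_⟩
  obtain ⟨s, hs⟩ : S.Nonempty := by
    rw [Set.nonempty_iff_ne_empty]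
    rintro rfl
    simp only [nbhd, Set.mem_empty_iff_false, false_and, exists_false, Set.ofPred_false,
      Set.empty_inter, Set.ncard_empty, Nat.cast_zero] at hS
    linarith
  have hremove : ((nbhd G (S \ {s}) ∩ B).ncard : ℝ) < r := by
    by_contra! hle
    have hcard := hmin (j := S \ {s}) ⟨Set.sdiff_subset.trans hSA, hle⟩
      (Set.ncard_le_ncard Set.sdiff_subset)
    exact hcard.not_gt (Set.ncard_sdiff_singleton_lt_of_mem hs)
  have hcover : nbhd G S ∩ B ⊆ (nbhd G (S \ {s}) ∩ B) ∪ G.neighborSet s := by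
    rintro z ⟨⟨y, hy, hyz⟩, hz⟩
    by_cases hys : y = s
    · exact Or.inr (hys ▸ hyz)
    · exact Or.inl ⟨⟨y, ⟨hy, hys⟩, hyz⟩, hz⟩
  have hcard : ((nbhd G S ∩ B).ncard : ℝ) ≤
      (nbhd G (S \ {s}) ∩ B).ncard + (G.neighborSet s).ncard := by
    exact_mod_cast (Set.ncard_le_ncard hcover).trans (Set.ncard_union_le _ _)
  linarith [hd s]

/- The exceptional set `Z` is a largest non-expanding set of fewer than `b` vertices: a
non-expanding set outside `Z` could be added to it. -/
theorem NoAnticompletePair.exists_expanding_of_ncard_le (h : NoAnticompletePair G a b)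
    (hb : 0 < b) (hbm : b ≤ m) (hα : 0 ≤ α) (hCC' : Disjoint C C')
    (hC' : 2 * α * m + a ≤ C'.ncard) :
    ∃ Z ⊆ C, (Z.ncard : ℝ) < b ∧
      ∀ Y ⊆ C \ Z, (Y.ncard : ℝ) ≤ m → α * Y.ncard ≤ (nbhd G Y ∩ C').ncard := by
  obtain ⟨Z, ⟨hZC, hZb, hZ⟩, hmax⟩ := Set.Finite.exists_maximalFor (fun Z : Set V => Z.ncard)
    {Z | Z ⊆ C ∧ (Z.ncard : ℝ) < b ∧ ((nbhd G Z ∩ C').ncard : ℝ) ≤ α * Z.ncard}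
    (Set.toFinite _) ⟨∅, by simp [nbhd, hb]⟩
  refine ⟨Z, hZC, hZb, fun Y hY hYm => ?_⟩
  by_contra! hlt
  have hcard : ((Z ∪ Y).ncard : ℝ) = Z.ncard + Y.ncard := by
    exact_mod_cast Set.ncard_union_eq (Set.disjoint_sdiff_right.mono_right hY)
  have hYpos : 0 < Y.ncard := by
    rw [pos_iff_ne_zero]
    rintro hY0
    rw [hY0, Nat.cast_zero, mul_zero] at hlt
    exact (Nat.cast_nonneg _).not_gt hlt
  have hZYC : Z ∪ Y ⊆ C := Set.union_subset hZC (hY.trans Set.sdiff_subset)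
  have hZY : ((nbhd G (Z ∪ Y) ∩ C').ncard : ℝ) ≤ α * (Z ∪ Y).ncard := by
    have hle : ((nbhd G (Z ∪ Y) ∩ C').ncard : ℝ) ≤
        (nbhd G Z ∩ C').ncard + (nbhd G Y ∩ C').ncard := by
      rw [nbhd_union, Set.union_inter_distrib_right]
      exact_mod_cast Set.ncard_union_le _ _
    rw [hcard, mul_add]
    linarith
  have hZYb : ((Z ∪ Y).ncard : ℝ) < b := by
    by_contra! hle
    have hmissed := h.ncard_diff_nbhd_lt (hCC'.mono_left hZYC) hle
    have hle : α * (Z ∪ Y).ncard ≤ α * (2 * m) := by gcongr; linarith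
    linarith [ncard_inter_add_ncard_diff (nbhd G (Z ∪ Y)) C']
  have hle := hmax (j := Z ∪ Y) ⟨hZYC, hZYb, hZY⟩ (Set.ncard_le_ncard Set.subset_union_left)
  rw [← Nat.cast_pos (α := ℝ)] at hYpos
  rw [← Nat.cast_le (α := ℝ), hcard] at hle
  linarith

theorem mul_min_le_ncard_nbhd_inter (hm : 1 ≤ m) (hα : 0 ≤ α)
    (hB : ∀ Y ⊆ B, (Y.ncard : ℝ) ≤ m → α * Y.ncard ≤ (nbhd G Y ∩ C).ncard) (hYB : Y ⊆ B) :
    α / 2 * min (Y.ncard : ℝ) m ≤ (nbhd G Y ∩ C).ncard := by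
  have hfloor : (⌊min (Y.ncard : ℝ) m⌋₊ : ℝ) ≤ min (Y.ncard : ℝ) m := Nat.floor_le (by positivity)
  obtain ⟨S, hSY, hS⟩ := Set.exists_subset_card_eq (s := Y) (n := ⌊min (Y.ncard : ℝ) m⌋₊)
    (by exact_mod_cast hfloor.trans (min_le_left _ _))
  have hhalf : min (Y.ncard : ℝ) m / 2 ≤ S.ncard := by
    rw [hS]
    rcases Nat.eq_zero_or_pos Y.ncard with hY0 | hYpos
    · simp only [hY0, Nat.cast_zero, min_eq_left (zero_le_one.trans hm), zero_div, Nat.floor_zero,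
        le_refl]
    · have hone : (1 : ℝ) ≤ min (Y.ncard : ℝ) m := le_min (by exact_mod_cast hYpos) hm
      have hfloor_one : (1 : ℝ) ≤ ⌊min (Y.ncard : ℝ) m⌋₊ := by
        exact_mod_cast (Nat.one_le_floor_iff _).2 hone
      linarith [Nat.lt_floor_add_one (min (Y.ncard : ℝ) m)]
  calc α / 2 * min (Y.ncard : ℝ) m = α * (min (Y.ncard : ℝ) m / 2) := by ring
    _ ≤ α * S.ncard := by gcongr
    _ ≤ (nbhd G S ∩ C).ncard :=
      hB S (hSY.trans hYB) (hS ▸ hfloor.trans (min_le_right _ _))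
    _ ≤ (nbhd G Y ∩ C).ncard := by
      exact_mod_cast Set.ncard_le_ncard (Set.inter_subset_inter_left _ (nbhd_mono hSY))

theorem mul_min_mul_pow_succ_le {q x : ℝ} (hq : 0 ≤ q) (hq1 : q ≤ 1) (hm : 0 ≤ m) (hN : 1 ≤ N)
    (t : ℕ) : q * min (x * N ^ (t + 1)) m ≤ min (q * N * min x m * N ^ t) m := by
  have : 0 ≤ N := zero_le_one.trans hN
  refine le_min ?_ ((mul_le_mul_of_nonneg_left (min_le_right _ _) hq).trans
    (mul_le_of_le_one_left hm hq1))
  calc q * min (x * N ^ (t + 1)) m ≤ q * min (x * N ^ (t + 1)) (m * N ^ (t + 1)) := by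
        gcongr
        exact le_mul_of_one_le_right hm (one_le_pow₀ hN)
    _ = q * N * min x m * N ^ t := by
        rw [← min_mul_of_nonneg _ _ (by positivity), pow_succ]
        ring

theorem NoAnticompletePair.exists_layers_expanding
    (h : NoAnticompletePair G (ε * (N * m)) (ε * m)) (hN : 1 ≤ N) (hm : 1 ≤ m) (hε : 0 < ε)
    (hθ : θ ≤ 1) (hεθ : ε ≤ θ / 4) (t : ℕ) (C : ℕ → Set V)
    (hC : ∀ i ≤ t, θ * (N * m) ≤ (C i).ncard) (hdisj : (Set.Iic t).PairwiseDisjoint C) :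
    ∃ B ⊆ C 0, θ / 2 * (N * m) ≤ B.ncard ∧
      ∀ Y ⊆ B, (θ / 16) ^ t * min (Y.ncard * N ^ t) m ≤ (layer G C Y t).ncard := by
  have hθ0 : 0 < θ := by linarith
  have hmN : m ≤ N * m := le_mul_of_one_le_left (by linarith) hN
  induction t generalizing C with
  | zero =>
    refine ⟨C 0, subset_rfl, le_trans ?_ (hC 0 le_rfl), fun Y _ => by simp [layer]⟩
    gcongr
    linarith
  | succ t ih =>
    obtain ⟨B, hB, hBcard, hBexp⟩ := ih (fun i => C (i + 1)) (fun i hi => hC _ (by omega))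
      fun i hi j hj hij => hdisj (Nat.succ_le_succ hi) (Nat.succ_le_succ hj) (by simpa using hij)
    obtain ⟨Z, hZ, hZcard, hZexp⟩ := h.exists_expanding_of_ncard_le (α := θ / 8 * N) (m := m)
      (C := C 0) (C' := B) (by positivity)
      (mul_le_of_le_one_left (by linarith) (by linarith)) (by positivity)
      ((hdisj (Nat.zero_le _) (by simp) zero_ne_one).mono_right hB)
      (by nlinarith)
    refine ⟨C 0 \ Z, Set.sdiff_subset, ?_, fun Y hY => ?_⟩
    · have hcard : ((C 0 \ Z).ncard : ℝ) + Z.ncard = (C 0).ncard := by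
        exact_mod_cast Set.ncard_sdiff_add_ncard_of_subset hZ
      nlinarith [hC 0 (Nat.zero_le _)]
    · have hexp := mul_min_le_ncard_nbhd_inter hm (by positivity) hZexp hY
      calc (θ / 16) ^ (t + 1) * min (Y.ncard * N ^ (t + 1)) m
          = (θ / 16) ^ t * (θ / 16 * min (Y.ncard * N ^ (t + 1)) m) := by ring
        _ ≤ (θ / 16) ^ t * min (θ / 16 * N * min (Y.ncard : ℝ) m * N ^ t) m := by
          gcongr
          exact mul_min_mul_pow_succ_le (by positivity) (by linarith) (by linarith) hN t
        _ ≤ (θ / 16) ^ t * min ((nbhd G Y ∩ B).ncard * N ^ t) m := by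
          gcongr
          linarith
        _ ≤ (layer G (fun i => C (i + 1)) (nbhd G Y ∩ B) t).ncard :=
          hBexp _ Set.inter_subset_right
        _ ≤ (layer G C Y (t + 1)).ncard := by
          rw [layer_succ_eq]
          exact_mod_cast Set.ncard_le_ncard (layer_mono (Set.inter_subset_inter_right _ hB) t)

theorem NoAnticompletePair.exists_large_layer
    (h : NoAnticompletePair G (ε * N ^ (t + 1)) (ε * N ^ t)) (hN : 1 ≤ N) (hε : 0 < ε)
    (hθ : θ ≤ 1) (hεθ : ε ≤ θ / 4) (hεt : ε ≤ (θ / 16) ^ t) (C : ℕ → Set V)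
    (hC : ∀ i ≤ t, θ * N ^ (t + 1) ≤ (C i).ncard) (hdisj : (Set.Iic t).PairwiseDisjoint C) :
    ∃ x ∈ C 0, ε * N ^ t ≤ (layer G C {x} t).ncard := by
  rw [pow_succ'] at h hC
  obtain ⟨B, hB, hBcard, hBexp⟩ :=
    h.exists_layers_expanding hN (one_le_pow₀ hN) hε hθ hεθ t C hC hdisj
  have hθ0 : 0 < θ := by linarith
  have hpos : (0 : ℝ) < B.ncard := lt_of_lt_of_le (by positivity) hBcard
  obtain ⟨x, hx⟩ := (Set.ncard_pos (Set.toFinite B)).1 (by exact_mod_cast hpos)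
  have hlayer := hBexp {x} (Set.singleton_subset_iff.2 hx)
  rw [Set.ncard_singleton, Nat.cast_one, one_mul, min_self] at hlayer
  exact ⟨x, hB hx, le_trans (by gcongr) hlayer⟩

end Expansion

/-! ### Ultraproducts of graphs -/

section Ultraproduct

open Filter Topology

variable {ι : Type*} {φ : Ultrafilter ι} {V : ι → Type*} {G : ∀ i, SimpleGraph (V i)}

/-- A sequence representing a vertex of an ultraproduct, fixed by choice. -/
noncomputable def rep (x : (φ : Filter ι).Product V) : ∀ i, V i :=
  Quotient.out (s := productSetoid (φ : Filter ι) V) x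

variable (φ) in
/-- The ultraproduct of a family of graphs. -/
def ultraproduct (G : ∀ i, SimpleGraph (V i)) : SimpleGraph ((φ : Filter ι).Product V) where
  Adj x y := ∀ᶠ i in φ, (G i).Adj (rep x i) (rep y i)
  symm := ⟨fun _ _ h => h.mono fun _ hi => hi.symm⟩
  loopless := ⟨fun _ h => let ⟨i, hi⟩ := h.exists; (G i).irrefl hi⟩

variable (φ) in
/-- The ultraproduct of a family of sets of vertices, as a set of vertices of the ultraproduct. -/
def internalSet (A : ∀ i, Set (V i)) : Set ((φ : Filter ι).Product V) :=
  {x | ∀ᶠ i in φ, rep x i ∈ A i}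

/-- A set of vertices of an ultraproduct is big if it is internal and its factors contain a fixed
positive proportion of the vertices. -/
def IsBig (S : Set ((φ : Filter ι).Product V)) : Prop :=
  ∃ A, internalSet φ A = S ∧ ∃ δ : ℝ, 0 < δ ∧ ∀ᶠ i in φ, δ * Nat.card (V i) ≤ (A i).ncard

variable {A B : ∀ i, Set (V i)} {x y : (φ : Filter ι).Product V}

theorem eventually_rep_eq_iff : (∀ᶠ i in φ, rep x i = rep y i) ↔ x = y :=
  Quotient.out_equiv_out (s := productSetoid (φ : Filter ι) V)

theorem exists_eventually_rep_iff [∀ i, Nonempty (V i)] {P : ∀ i, V i → Prop} :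
    (∃ x : (φ : Filter ι).Product V, ∀ᶠ i in φ, P i (rep x i)) ↔ ∀ᶠ i in φ, ∃ v, P i v := by
  refine ⟨fun ⟨x, hx⟩ => hx.mono fun i hi => ⟨_, hi⟩, fun h => ?_⟩
  obtain ⟨f, hf⟩ := skolem.1 h
  refine ⟨Quotient.mk (productSetoid (φ : Filter ι) V) f, ?_⟩
  have hrep : ∀ᶠ i in φ, rep (Quotient.mk (productSetoid (φ : Filter ι) V) f) i = f i :=
    Quotient.mk_out (s := productSetoid (φ : Filter ι) V) f
  filter_upwards [hf, hrep] with i hi hi'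
  rwa [hi']

theorem isIndContained_of_ultraproduct {W : Type*} [Finite W] {H : SimpleGraph W}
    (h : H.IsIndContained (ultraproduct φ G)) : ∃ i, H.IsIndContained (G i) := by
  obtain ⟨f⟩ := h
  have hadj : ∀ᶠ i in φ, ∀ a b, (G i).Adj (rep (f a) i) (rep (f b) i) ↔ H.Adj a b := by
    refine eventually_all.2 fun a => eventually_all.2 fun b => ?_
    by_cases hab : H.Adj a b
    · have hab' : ∀ᶠ i in φ, (G i).Adj (rep (f a) i) (rep (f b) i) := f.map_adj_iff.2 hab
      exact hab'.mono fun i hi => iff_of_true hi hab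
    · have hab' : ¬ ∀ᶠ i in φ, (G i).Adj (rep (f a) i) (rep (f b) i) :=
        fun hadj => hab (f.map_adj_iff.1 hadj)
      exact (Ultrafilter.eventually_not.2 hab').mono fun i hi => iff_of_false hi hab
  have hinj : ∀ᶠ i in φ, ∀ a b, rep (f a) i = rep (f b) i → a = b := by
    refine eventually_all.2 fun a => eventually_all.2 fun b => ?_
    by_cases hab : a = b
    · exact Eventually.of_forall fun _ _ => hab
    · have hab' := Ultrafilter.eventually_not.2
        (eventually_rep_eq_iff.not.2 fun heq => hab (f.injective heq))
      exact hab'.mono fun i hi heq => (hi heq).elim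
  obtain ⟨i, hi, hi'⟩ := (hadj.and hinj).exists
  exact ⟨i, ⟨⟨⟨fun a => rep (f a) i, fun a b => hi' a b⟩, hi _ _⟩⟩⟩

theorem internalSet_singleton (x : (φ : Filter ι).Product V) :
    internalSet φ (fun i => {rep x i}) = {x} :=
  Set.ext fun _ => eventually_rep_eq_iff

theorem internalSet_univ : internalSet φ (fun i => (Set.univ : Set (V i))) = Set.univ :=
  Set.eq_univ_of_forall fun _ => Eventually.of_forall fun _ => Set.mem_univ _

theorem internalSet_inter :
    internalSet φ (fun i => A i ∩ B i) = internalSet φ A ∩ internalSet φ B :=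
  Set.ext fun _ => eventually_and

theorem internalSet_union :
    internalSet φ (fun i => A i ∪ B i) = internalSet φ A ∪ internalSet φ B :=
  Set.ext fun _ => Ultrafilter.eventually_or

theorem internalSet_diff : internalSet φ (fun i => A i \ B i) = internalSet φ A \ internalSet φ B :=
  Set.ext fun _ => eventually_and.trans (and_congr_right fun _ => Ultrafilter.eventually_not)

theorem isBig_univ : IsBig (Set.univ : Set ((φ : Filter ι).Product V)) :=
  ⟨_, internalSet_univ, 1, one_pos, by simp [Set.ncard_univ]⟩

theorem exists_forall_large_of_isBig {C : ℕ → Set ((φ : Filter ι).Product V)} {t : ℕ}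
    (hC : ∀ j ≤ t, IsBig (C j)) :
    ∃ (A : ℕ → ∀ i, Set (V i)) (θ : ℝ), (∀ j ≤ t, internalSet φ (A j) = C j) ∧ 0 < θ ∧ θ ≤ 1 ∧
      ∀ᶠ i in φ, ∀ j ≤ t, θ * Nat.card (V i) ≤ (A j i).ncard := by
  choose! A hAC δ hδ hA using hC
  obtain ⟨θ, hθδ, hθ, hθ1⟩ := (((Set.finite_Iic t).eventually_all.2 fun j hj =>
    Ioc_mem_nhdsGT (hδ j hj)).and (Ioc_mem_nhdsGT one_pos)).exists
  refine ⟨A, θ, hAC, hθ, hθ1, (Set.finite_Iic t).eventually_all.2 fun j hj => ?_⟩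
  filter_upwards [hA j hj] with i hi
  exact le_trans (by gcongr; exact (hθδ j hj).2) hi

section Nonempty

variable [∀ i, Nonempty (V i)]

theorem internalSet_subset_iff :
    internalSet φ A ⊆ internalSet φ B ↔ ∀ᶠ i in φ, A i ⊆ B i := by
  refine ⟨fun h => ?_, fun h x hx => by filter_upwards [h, hx] with i hi hxi using hi hxi⟩
  by_contra hcon
  obtain ⟨x, hx⟩ := exists_eventually_rep_iff.2
    ((Ultrafilter.eventually_not.2 hcon).mono fun i hi => Set.not_subset.1 hi)
  obtain ⟨i, hi, hi'⟩ := (hx.and (h (hx.mono fun i hi => hi.1))).exists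
  exact hi.2 hi'

theorem internalSet_eq_iff : internalSet φ A = internalSet φ B ↔ ∀ᶠ i in φ, A i = B i := by
  simp only [Set.Subset.antisymm_iff, internalSet_subset_iff, eventually_and]

theorem disjoint_internalSet_iff :
    Disjoint (internalSet φ A) (internalSet φ B) ↔ ∀ᶠ i in φ, Disjoint (A i) (B i) := by
  have hempty : internalSet φ (fun i => (∅ : Set (V i))) = ∅ :=
    Set.eq_empty_of_forall_notMem fun _ hx => hx.exists.choose_spec
  simp only [Set.disjoint_iff_inter_eq_empty]
  rw [← internalSet_inter, ← hempty, internalSet_eq_iff]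

theorem internalSet_nbhd :
    internalSet φ (fun i => nbhd (G i) (A i)) = nbhd (ultraproduct φ G) (internalSet φ A) := by
  ext z
  simp only [nbhd, Set.mem_ofPred_eq, internalSet, ultraproduct, ← eventually_and]
  exact exists_eventually_rep_iff.symm

theorem internalSet_layer {C : ℕ → Set ((φ : Filter ι).Product V)} {A : ℕ → ∀ i, Set (V i)}
    {n : ℕ} (hA : ∀ j ≤ n, internalSet φ (A j) = C j) (x : (φ : Filter ι).Product V) :
    internalSet φ (fun i => layer (G i) (fun j => A j i) {rep x i} n) =
      layer (ultraproduct φ G) C {x} n := by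
  induction n with
  | zero => exact internalSet_singleton x
  | succ n ih =>
    simp only [layer]
    rw [internalSet_inter, internalSet_nbhd, ih fun j hj => hA j (by omega), hA _ le_rfl]

theorem isBig_internalSet_iff : IsBig (internalSet φ A) ↔
    ∃ δ : ℝ, 0 < δ ∧ ∀ᶠ i in φ, δ * Nat.card (V i) ≤ (A i).ncard := by
  refine ⟨fun ⟨B, hB, δ, hδ, h⟩ => ⟨δ, hδ, ?_⟩, fun h => ⟨A, rfl, h⟩⟩
  filter_upwards [h, internalSet_eq_iff.1 hB] with i hi hBA
  rwa [← hBA]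

theorem isBig_or_isBig_of_union (h : IsBig (internalSet φ A ∪ internalSet φ B)) :
    IsBig (internalSet φ A) ∨ IsBig (internalSet φ B) := by
  rw [← internalSet_union, isBig_internalSet_iff] at h
  obtain ⟨δ, hδ, hAB⟩ := h
  have hhalf : ∀ᶠ i in φ, δ / 2 * Nat.card (V i) ≤ (A i).ncard ∨
      δ / 2 * Nat.card (V i) ≤ (B i).ncard := by
    filter_upwards [hAB] with i hi
    by_contra! hlt
    have hle : ((A i ∪ B i).ncard : ℝ) ≤ (A i).ncard + (B i).ncard := by
      exact_mod_cast Set.ncard_union_le _ _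
    linarith [hlt.1, hlt.2]
  exact (Ultrafilter.eventually_or.1 hhalf).imp
    (fun hA => isBig_internalSet_iff.2 ⟨δ / 2, half_pos hδ, hA⟩)
    (fun hB => isBig_internalSet_iff.2 ⟨δ / 2, half_pos hδ, hB⟩)

theorem eventually_pairwiseDisjoint {A : ℕ → ∀ i, Set (V i)} {s : Set ℕ} (hs : s.Finite)
    (h : s.PairwiseDisjoint fun j => internalSet φ (A j)) :
    ∀ᶠ i in φ, s.PairwiseDisjoint fun j => A j i := by
  refine hs.eventually_all.2 fun a ha => hs.eventually_all.2 fun b hb => ?_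
  exact eventually_imp_distrib_left.2 fun hab => disjoint_internalSet_iff.1 (h ha hb hab)

theorem IsBig.mono [∀ i, Finite (V i)] {S : Set ((φ : Filter ι).Product V)}
    (hS : IsBig S) (hSB : S ⊆ internalSet φ B) : IsBig (internalSet φ B) := by
  obtain ⟨A, rfl, δ, hδ, hA⟩ := hS
  refine isBig_internalSet_iff.2 ⟨δ, hδ, ?_⟩
  filter_upwards [hA, internalSet_subset_iff.1 hSB] with i hAi hABi
  exact hAi.trans (by exact_mod_cast Set.ncard_le_ncard hABi)

end Nonempty

/-! ### The limit of a sequence of sparse graphs -/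

variable (φ G) in
/-- Graphs on `N i ^ (t + 1)` vertices with ever smaller maximum degree and without ever smaller
anticomplete pairs, both measured by an infinitesimal proportion `ε i` that still amounts to at
least one vertex. -/
structure SparseFamily (t : ℕ) (N ε : ι → ℝ) : Prop where
  one_le : ∀ i, 1 ≤ N i
  card_eq : ∀ i, (Nat.card (V i) : ℝ) = N i ^ (t + 1)
  one_le_mul_card : ∀ i, 1 ≤ ε i * Nat.card (V i)
  tendsto : Tendsto ε φ (𝓝 0)
  ncard_neighborSet_le : ∀ i x, (((G i).neighborSet x).ncard : ℝ) ≤ ε i * Nat.card (V i)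
  noAnticompletePair : ∀ i, NoAnticompletePair (G i) (ε i * N i ^ (t + 1)) (ε i * N i ^ t)

namespace SparseFamily

variable {t : ℕ} {N ε : ι → ℝ} {δ : ℝ} (h : SparseFamily φ G t N ε)
include h

theorem pos (i : ι) : 0 < ε i :=
  pos_of_mul_pos_left (zero_lt_one.trans_le (h.one_le_mul_card i)) (Nat.cast_nonneg _)

theorem eventually_le (hδ : 0 < δ) : ∀ᶠ i in φ, ε i ≤ δ :=
  h.tendsto.eventually_le_const hδ

theorem eventually_mul_card_le (hδ : 0 < δ) :
    ∀ᶠ i in φ, ε i * Nat.card (V i) ≤ δ * Nat.card (V i) :=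
  (h.eventually_le hδ).mono fun _ hi => mul_le_mul_of_nonneg_right hi (Nat.cast_nonneg _)

theorem mul_pow_le_mul_card (i : ι) : ε i * N i ^ t ≤ ε i * Nat.card (V i) := by
  rw [h.card_eq]
  exact mul_le_mul_of_nonneg_left (pow_le_pow_right₀ (h.one_le i) t.le_succ) (h.pos i).le

variable [∀ i, Nonempty (V i)] [∀ i, Finite (V i)]

theorem isBig_nbhd_inter (hA : ∀ᶠ i in φ, ε i * N i ^ t ≤ (A i).ncard)
    (hB : IsBig (internalSet φ B)) :
    IsBig (nbhd (ultraproduct φ G) (internalSet φ A) ∩ internalSet φ B) := by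
  obtain ⟨δ, hδ, hB⟩ := isBig_internalSet_iff.1 hB
  rw [← internalSet_nbhd, ← internalSet_inter]
  refine isBig_internalSet_iff.2 ⟨δ / 4, by positivity, ?_⟩
  filter_upwards [hA, hB, h.eventually_mul_card_le (δ := δ / 4) (by positivity)] with i hAi hBi hεi
  have hN : 0 ≤ N i := zero_le_one.trans (h.one_le i)
  have hnbhd := (h.noAnticompletePair i).le_ncard_nbhd_inter (B := B i)
    (mul_nonneg (h.pos i).le (pow_nonneg hN t)) hAi
  rw [← h.card_eq] at hnbhd
  linarith [h.mul_pow_le_mul_card i, h.one_le_mul_card i]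

theorem not_isBig_neighborSet (x : (φ : Filter ι).Product V) :
    ¬ IsBig ((ultraproduct φ G).neighborSet x) := by
  intro hbig
  obtain ⟨δ, hδ, hlarge⟩ :=
    isBig_internalSet_iff (A := fun i => (G i).neighborSet (rep x i)).1 hbig
  obtain ⟨i, hi, hεi⟩ := (hlarge.and (h.eventually_le (half_pos hδ))).exists
  have hcard : (0 : ℝ) < Nat.card (V i) := by exact_mod_cast Nat.card_pos
  nlinarith [h.ncard_neighborSet_le i (rep x i)]

theorem exists_halving (hAB : IsBig (nbhd (ultraproduct φ G) (internalSet φ A) ∩ internalSet φ B)) :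
    ∃ S : ∀ i, Set (V i), internalSet φ S ⊆ internalSet φ A ∧
      IsBig (nbhd (ultraproduct φ G) (internalSet φ S) ∩ internalSet φ B) ∧
      IsBig (internalSet φ B \ nbhd (ultraproduct φ G) (internalSet φ S)) := by
  rw [← internalSet_nbhd, ← internalSet_inter, isBig_internalSet_iff] at hAB
  obtain ⟨δ, hδ, hAB⟩ := hAB
  have hS : ∀ᶠ i in φ, ∃ S ⊆ A i, δ / 2 * Nat.card (V i) ≤ (nbhd (G i) S ∩ B i).ncard ∧
      δ / 4 * Nat.card (V i) ≤ (B i \ nbhd (G i) S).ncard := by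
    filter_upwards [hAB, h.eventually_mul_card_le (δ := δ / 4) (by positivity)] with i hi hεi
    have hcard : (0 : ℝ) < Nat.card (V i) := by exact_mod_cast Nat.card_pos
    obtain ⟨S, hSA, hS, hS_lt⟩ := exists_subset_ncard_nbhd_inter_lt
      (fun x => (h.ncard_neighborSet_le i x).trans hεi) (r := δ / 2 * Nat.card (V i))
      (by positivity) (le_trans (by gcongr; linarith) hi)
    have hle : ((nbhd (G i) (A i) ∩ B i).ncard : ℝ) ≤ (B i).ncard := by
      exact_mod_cast Set.ncard_le_ncard Set.inter_subset_right
    exact ⟨S, hSA, hS, by linarith [ncard_inter_add_ncard_diff (nbhd (G i) S) (B i)]⟩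
  obtain ⟨S, hS⟩ := skolem.1 hS
  refine ⟨S, internalSet_subset_iff.2 (hS.mono fun i hi => hi.1), ?_, ?_⟩
  · rw [← internalSet_nbhd, ← internalSet_inter]
    exact isBig_internalSet_iff.2 ⟨δ / 2, by positivity, hS.mono fun i hi => hi.2.1⟩
  · rw [← internalSet_nbhd, ← internalSet_diff]
    exact isBig_internalSet_iff.2 ⟨δ / 4, by positivity, hS.mono fun i hi => hi.2.2⟩

theorem exists_isBig_disjoint (hA : IsBig (internalSet φ A)) :
    ∃ B ⊆ internalSet φ A, ∃ C ⊆ internalSet φ A, IsBig B ∧ IsBig C ∧ Disjoint B C := by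
  obtain ⟨δ, hδ, hA⟩ := isBig_internalSet_iff.1 hA
  choose S hS hcard using fun i =>
    Set.exists_subset_card_eq (s := A i) (n := (A i).ncard / 2) (Nat.div_le_self _ _)
  refine ⟨internalSet φ S, internalSet_subset_iff.2 (.of_forall hS),
    internalSet φ A \ internalSet φ S, Set.sdiff_subset, ?_, ?_, Set.disjoint_sdiff_right⟩
  · refine isBig_internalSet_iff.2 ⟨δ / 4, by positivity, ?_⟩
    filter_upwards [hA, h.eventually_mul_card_le (δ := δ / 2) (by positivity)] with i hi hεi
    have hhalf : ((A i).ncard : ℝ) ≤ 2 * (S i).ncard + 1 := by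
      rw [hcard]
      exact_mod_cast (by omega : (A i).ncard ≤ 2 * ((A i).ncard / 2) + 1)
    linarith [h.one_le_mul_card i]
  · rw [← internalSet_diff]
    refine isBig_internalSet_iff.2 ⟨δ / 2, by positivity, ?_⟩
    filter_upwards [hA] with i hi
    have hsum := Set.ncard_sdiff_add_ncard_of_subset (hS i)
    rw [hcard] at hsum
    have hhalf : ((A i).ncard : ℝ) ≤ 2 * (A i \ S i).ncard := by
      exact_mod_cast (by omega : (A i).ncard ≤ 2 * (A i \ S i).ncard)
    linarith

theorem exists_expanding (C : ℕ → Set ((φ : Filter ι).Product V)) (hC : ∀ j ≤ t, IsBig (C j))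
    (hdisj : (Set.Iic t).PairwiseDisjoint C) :
    ∃ x ∈ C 0, ∀ D, IsBig D →
      IsBig (nbhd (ultraproduct φ G) (layer (ultraproduct φ G) C {x} t) ∩ D) := by
  obtain ⟨A, θ, hAC, hθ, hθ1, hA⟩ := exists_forall_large_of_isBig hC
  have hAdisj : ∀ᶠ i in φ, (Set.Iic t).PairwiseDisjoint fun j => A j i := by
    refine eventually_pairwiseDisjoint (Set.finite_Iic t) fun a ha b hb hab => ?_
    simpa only [Function.onFun, hAC a ha, hAC b hb] using hdisj ha hb hab
  have hlarge : ∀ᶠ i in φ, ∃ v, v ∈ A 0 i ∧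
      ε i * N i ^ t ≤ (layer (G i) (fun j => A j i) {v} t).ncard := by
    filter_upwards [hAdisj, hA, h.eventually_le (δ := θ / 4) (by positivity),
      h.eventually_le (δ := (θ / 16) ^ t) (by positivity)] with i hdisj_i hAi hεθ hεt
    exact (h.noAnticompletePair i).exists_large_layer (h.one_le i) (h.pos i) hθ1 hεθ hεt
      (fun j => A j i) (fun j hj => h.card_eq i ▸ hAi j hj) hdisj_i
  obtain ⟨x, hx⟩ := exists_eventually_rep_iff.2 hlarge
  refine ⟨x, hAC 0 (Nat.zero_le t) ▸ hx.mono fun i hi => hi.1, ?_⟩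
  rintro D ⟨B, rfl, hB⟩
  rw [← internalSet_layer hAC]
  exact h.isBig_nbhd_inter (hx.mono fun i hi => hi.2) ⟨B, rfl, hB⟩

/-- The ultraproduct of a sparse family, its internal sets being the ultraproducts of sets. -/
def sparseLimit : SparseLimit (ultraproduct φ G) t where
  Internal S := ∃ A, internalSet φ A = S
  Big := IsBig
  internal_of_big := fun ⟨A, hA, _⟩ => ⟨A, hA⟩
  internal_singleton x := ⟨_, internalSet_singleton x⟩
  internal_inter := by rintro _ _ ⟨A, rfl⟩ ⟨B, rfl⟩; exact ⟨_, internalSet_inter⟩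
  internal_union := by rintro _ _ ⟨A, rfl⟩ ⟨B, rfl⟩; exact ⟨_, internalSet_union⟩
  internal_diff := by rintro _ _ ⟨A, rfl⟩ ⟨B, rfl⟩; exact ⟨_, internalSet_diff⟩
  internal_nbhd := by rintro _ ⟨A, rfl⟩; exact ⟨_, internalSet_nbhd⟩
  big_mono := by rintro _ _ hA ⟨B, rfl⟩ hAB; exact hA.mono hAB
  big_or_big_of_union := by rintro _ _ ⟨A, rfl⟩ ⟨B, rfl⟩ hAB; exact isBig_or_isBig_of_union hAB
  big_univ := isBig_univ
  exists_big_disjoint := by rintro _ ⟨A, rfl, hA⟩; exact h.exists_isBig_disjoint ⟨A, rfl, hA⟩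
  not_big_neighborSet := h.not_isBig_neighborSet
  big_nbhd_inter := by
    rintro _ _ ⟨A, rfl, δ, hδ, hA⟩ ⟨B, rfl, hB⟩
    refine h.isBig_nbhd_inter ?_ ⟨B, rfl, hB⟩
    filter_upwards [hA, h.eventually_mul_card_le hδ] with i hAi hεi
    exact (h.mul_pow_le_mul_card i).trans (hεi.trans hAi)
  exists_halving := by
    rintro _ _ ⟨A, rfl⟩ ⟨B, rfl⟩ hAB
    obtain ⟨S, hSA, hin, hout⟩ := h.exists_halving hAB
    exact ⟨_, hSA, ⟨S, rfl⟩, hin, hout⟩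
  exists_expanding := h.exists_expanding

end SparseFamily

end Ultraproduct

section SparseGraphs

open Filter

universe u

theorem NoAnticompletePair.one_le_mul_card {V : Type*} [Finite V] [Nontrivial V]
    {G : SimpleGraph V} {N ε : ℝ} {t : ℕ} (hN : 1 ≤ N) (hcard : (Nat.card V : ℝ) = N ^ (t + 1))
    (hε : 0 < ε) (hdeg : ∀ x, ((G.neighborSet x).ncard : ℝ) < ε * Nat.card V)
    (h : NoAnticompletePair G (ε * N ^ (t + 1)) (ε * N ^ t)) : 1 ≤ ε * Nat.card V := by
  by_contra! hlt
  have ha : ε * N ^ (t + 1) ≤ 1 := hcard ▸ hlt.le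
  have hb : ε * N ^ t ≤ 1 :=
    le_trans (mul_le_mul_of_nonneg_left (pow_le_pow_right₀ hN t.le_succ) hε.le) ha
  obtain ⟨x, y, hxy⟩ := exists_pair_ne V
  have hpos : 1 ≤ (G.neighborSet x).ncard :=
    (Set.ncard_pos (Set.toFinite _)).2 ⟨y, h.adj_of_ne ha hb hxy⟩
  have hpos' : (1 : ℝ) ≤ (G.neighborSet x).ncard := by exact_mod_cast hpos
  linarith [hdeg x]

theorem exists_not_noAnticompletePair_of_sparse (t ℓ : ℕ) (hℓ : 4 * (t + 1) + 5 ≤ ℓ) :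
    ∃ ε : ℝ, 0 < ε ∧ ∀ (V : Type u) [Finite V] [Nontrivial V] (G : SimpleGraph V) (N : ℝ), 1 ≤ N →
      (Nat.card V : ℝ) = N ^ (t + 1) →
      (∀ x, ((G.neighborSet x).ncard : ℝ) < ε * Nat.card V) →
      ¬ (SimpleGraph.cycleGraph ℓ).IsIndContained G →
      ¬ NoAnticompletePair G (ε * N ^ (t + 1)) (ε * N ^ t) := by
  by_contra! hcon
  have hpos : ∀ i : ℕ, 0 < 1 / ((i : ℝ) + 1) := fun i => by positivity
  choose V hfin hnt G N hN hcard hdeg hfree hpair using fun i => hcon _ (hpos i)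
  have hfamily : SparseFamily (hyperfilter ℕ) G t N fun i => 1 / ((i : ℝ) + 1) :=
    { one_le := hN
      card_eq := hcard
      one_le_mul_card := fun i => (hpair i).one_le_mul_card (hN i) (hcard i) (hpos i) (hdeg i)
      tendsto := tendsto_one_div_add_atTop_nhds_zero_nat.mono_left Nat.hyperfilter_le_atTop
      ncard_neighborSet_le := fun i x => (hdeg i x).le
      noAnticompletePair := hpair }
  obtain ⟨i, hi⟩ := isIndContained_of_ultraproduct
    (hfamily.sparseLimit.isIndContained_cycleGraph hℓ)
  exact hfree i hi

end SparseGraphs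

/-! ### Rödl's theorem: sparse or co-sparse vertex sets of linear size -/

section Rodl

open Finset

universe u

variable {V : Type*} {G : SimpleGraph V} {A A' B W W' X : Finset V} {η η' δ c : ℝ} {a h s : ℕ}

open Classical in
/-- Every vertex in `A` has at most `η * |B|` neighbours in `B`. In particular, `IsSparseTo G η A A`
bounds the maximum degree of the subgraph induced on `A`. -/
def IsSparseTo (G : SimpleGraph V) (η : ℝ) (A B : Finset V) : Prop :=
  ∀ a ∈ A, (#{b ∈ B | G.Adj a b} : ℝ) ≤ η * #B

theorem IsSparseTo.mono_left (h : IsSparseTo G η A B) (hA : A' ⊆ A) : IsSparseTo G η A' B :=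
  fun a ha => h a (hA ha)

theorem IsSparseTo.mono (h : IsSparseTo G η A B) (hη : η ≤ η') : IsSparseTo G η' A B :=
  fun a ha => (h a ha).trans (by gcongr)

open Classical in
theorem isSparseTo_or_compl {p : Prop} (h : ∀ a ∈ A, (#{b ∈ B | G.Adj a b ↔ p} : ℝ) ≤ η * #B) :
    IsSparseTo G η A B ∨ IsSparseTo Gᶜ η A B := by
  by_cases hp : p
  · exact .inl fun a ha => by simpa only [hp, iff_true] using h a ha
  · refine .inr fun a ha => le_trans ?_ (h a ha)
    gcongr with b
    simp +contextual [hp]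

theorem comap_cons_eq {H : SimpleGraph (Fin (h + 1))} {v : V} {f : Fin h → V}
    (hv : ∀ j, G.Adj v (f j) ↔ H.Adj 0 j.succ) (hf : G.comap f = H.comap Fin.succ) :
    G.comap (Fin.cons v f : Fin (h + 1) → V) = H := by
  ext i j
  cases i using Fin.cases with
  | zero =>
    cases j using Fin.cases with
    | zero => simp
    | succ j => exact hv j
  | succ i =>
    cases j using Fin.cases with
    | zero => exact (G.adj_comm _ _).trans ((hv i).trans (H.adj_comm _ _))
    | succ j => exact iff_of_eq congr($hf |>.Adj i j)

open Classical in
theorem exists_isSparseTo_of_card_lt {S : Fin h → Finset V} {p : Fin h → Prop} {M : ℝ} (hη : 0 ≤ η)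
    (hM : 0 < M) (hA : M ≤ #A) (hS : ∀ j, M ≤ #(S j))
    (hlt : ∀ a ∈ A, ∃ j, (#{b ∈ S j | G.Adj a b ↔ p j} : ℝ) < η * M) :
    ∃ j, ∃ A' ⊆ A, M / (h + 1) ≤ #A' ∧
      (IsSparseTo G η A' (S j) ∨ IsSparseTo Gᶜ η A' (S j)) := by
  have hne : A.Nonempty := card_pos.1 (by exact_mod_cast hM.trans_le hA)
  have : Nonempty (Fin h) := let ⟨a, ha⟩ := hne; ⟨(hlt a ha).choose⟩
  choose! j hj using hlt
  have hpigeon : #(univ : Finset (Fin h)) • (M / (h + 1)) ≤ #A := by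
    rw [card_univ, Fintype.card_fin, nsmul_eq_mul]
    refine le_trans ?_ hA
    rw [mul_div_assoc', div_le_iff₀ (by positivity)]
    linarith
  obtain ⟨k, -, hk⟩ := exists_le_card_fiber_of_nsmul_le_card_of_maps_to
    (fun a _ => mem_univ (j a)) univ_nonempty hpigeon
  refine ⟨k, {a ∈ A | j a = k}, filter_subset _ _, hk, isSparseTo_or_compl (p := p k) ?_⟩
  intro a ha
  obtain ⟨haA, rfl⟩ := mem_filter.1 ha
  exact (hj a haA).le.trans (by gcongr; exact hS _)

/-- The greedy embedding: if no vertex of the first set has the prescribed adjacency to many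
vertices of each of the other sets, then the pigeonhole principle yields a pair of extreme
density. -/
theorem exists_transversal_or_isSparseTo (hη : 0 < η) (hη1 : η ≤ 1) (H : SimpleGraph (Fin h))
    (S : Fin h → Finset V) {M : ℝ} (hM : 0 < M) (hS : ∀ i, M ≤ #(S i)) :
    (∃ f : Fin h → V, (∀ i, f i ∈ S i) ∧ G.comap f = H) ∨
      ∃ i j, i ≠ j ∧ ∃ A ⊆ S i, ∃ B ⊆ S j, η ^ h / (h + 1) * M ≤ #A ∧ η ^ h / (h + 1) * M ≤ #B ∧
        (IsSparseTo G η A B ∨ IsSparseTo Gᶜ η A B) := by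
  classical
  induction h generalizing M with
  | zero => exact .inl ⟨Fin.elim0, fun i => i.elim0, by ext i; exact i.elim0⟩
  | succ h ih =>
    let nb (a : V) (j : Fin h) : Finset V := {b ∈ S j.succ | G.Adj a b ↔ H.Adj 0 j.succ}
    by_cases hgood : ∃ a ∈ S 0, ∀ j, η * M ≤ #(nb a j)
    · obtain ⟨a, ha, hnb⟩ := hgood
      obtain ⟨f, hf, hfH⟩ | ⟨i, j, hij, A, hA, B, hB, hAc, hBc, hAB⟩ :=
        ih (H.comap Fin.succ) (nb a) (by positivity) hnb
      · refine .inl ⟨Fin.cons a f, Fin.cases ha fun i => (mem_filter.1 (hf i)).1, ?_⟩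
        exact comap_cons_eq (fun j => (mem_filter.1 (hf j)).2) hfH
      · have hle : η ^ (h + 1) / ((h + 1 : ℕ) + 1) * M ≤ η ^ h / (h + 1) * (η * M) := by
          rw [pow_succ, ← mul_assoc, div_mul_eq_mul_div _ _ η]
          gcongr
          simp
        exact .inr ⟨i.succ, j.succ, by simpa using hij, A, hA.trans (filter_subset _ _), B,
          hB.trans (filter_subset _ _), hle.trans hAc, hle.trans hBc, hAB⟩
    · push Not at hgood
      obtain ⟨j, A, hA, hAc, hAj⟩ := exists_isSparseTo_of_card_lt hη.le hM (hS 0)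
        (fun j => hS j.succ) hgood
      have hle : η ^ (h + 1) / ((h + 1 : ℕ) + 1) * M ≤ M / (h + 1) := by
        rw [div_mul_eq_mul_div]
        gcongr
        · exact mul_le_of_le_one_left hM.le (pow_le_one₀ hη.le hη1)
        · simp
      exact .inr ⟨0, j.succ, (Fin.succ_ne_zero j).symm, A, hA, _, subset_rfl, hle.trans hAc,
        hle.trans ((div_le_self hM.le (by simp)).trans (hS j.succ)), hAj⟩

theorem exists_pairwise_disjoint_subsets (hh : h ≠ 0) (hW : h ≤ #W) :
    ∃ S : Fin h → Finset V, (∀ i, S i ⊆ W) ∧ (∀ i, #W ≤ 2 * h * #(S i)) ∧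
      Pairwise (Function.onFun Disjoint S) := by
  classical
  obtain ⟨P, hP, hcard⟩ := Finpartition.exists_equipartition_card_eq W hh hW
  let e := (P.parts.equivFinOfCardEq hcard).symm
  refine ⟨fun i => e i, fun i => P.le (e i).2, fun i => ?_,
    fun i j hij => P.disjoint (e i).2 (e j).2 (Subtype.coe_injective.ne (e.injective.ne hij))⟩
  calc #W ≤ 2 * h * (#W / h) := by
        have hquot : 1 ≤ #W / h := (Nat.one_le_div_iff (by omega)).2 hW
        have hlt := Nat.lt_mul_div_succ #W (Nat.pos_of_ne_zero hh)
        nlinarith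
    _ ≤ 2 * h * #(e i : Finset V) := by
        gcongr
        simpa only [hcard] using hP.average_le_card_part (e i).2

/-- Every set `W` of vertices that is not too small contains disjoint sets `A`, `B` with
`δ * |W| ≤ |A| ≤ |B|` such that the edges or the non-edges between them are `η`-sparse. -/
def HasSparsePairs (G : SimpleGraph V) (η δ : ℝ) : Prop :=
  ∀ W : Finset V, 1 ≤ δ * #W → ∃ A ⊆ W, ∃ B ⊆ W, Disjoint A B ∧ #A ≤ #B ∧ δ * #W ≤ #A ∧
    (IsSparseTo G η A B ∨ IsSparseTo Gᶜ η A B)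

theorem hasSparsePairs_of_not_isIndContained (hη : 0 < η) (hη1 : η ≤ 1) {H : SimpleGraph (Fin h)}
    (hG : ¬ H.IsIndContained G) : HasSparsePairs G η (η ^ h / (2 * (h + 1) ^ 2)) := by
  intro W hW
  have hh : h ≠ 0 := by
    rintro rfl
    exact hG .of_isEmpty
  have hWh : h ≤ #W := by
    rw [div_mul_eq_mul_div, one_le_div (by positivity)] at hW
    have hle : η ^ h * #W ≤ #W := mul_le_of_le_one_left (by positivity) (pow_le_one₀ hη.le hη1)
    have : (h : ℝ) ≤ #W := by nlinarith
    exact_mod_cast this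
  obtain ⟨S, hSW, hS, hdisj⟩ := exists_pairwise_disjoint_subsets hh hWh
  have hh' : (0 : ℝ) < h := by positivity
  have hW' : (0 : ℝ) < #W := hh'.trans_le (by exact_mod_cast hWh)
  have hδ : η ^ h / (2 * (h + 1) ^ 2) * #W ≤ η ^ h / (h + 1) * (#W / (2 * h)) := by
    rw [div_mul_div_comm, div_mul_eq_mul_div]
    gcongr (_ / ?_)
    nlinarith
  obtain ⟨f, hf, rfl⟩ | ⟨i, j, hij, A, hA, B, hB, hAc, hBc, hAB⟩ :=
    exists_transversal_or_isSparseTo (G := G) hη hη1 H S (M := #W / (2 * h)) (by positivity)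
      fun i => (div_le_iff₀' (by positivity)).2 (by exact_mod_cast hS i)
  · have hinj : Function.Injective f := fun i j hfij => by
      by_contra hij
      exact disjoint_left.1 (hdisj hij) (hf i) (hfij ▸ hf j)
    exact absurd ⟨SimpleGraph.Embedding.comap ⟨f, hinj⟩ G⟩ hG
  · obtain ⟨A', hA', hcard⟩ := exists_subset_card_eq (min_le_left #A #B)
    refine ⟨A', hA'.trans (hA.trans (hSW i)), B, hB.trans (hSW j),
      ((hdisj hij).mono_left (hA'.trans hA)).mono_right hB, hcard ▸ min_le_right _ _, ?_,
      hAB.imp (·.mono_left hA') (·.mono_left hA')⟩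
    rw [hcard, Nat.cast_min]
    exact le_min (hδ.trans hAc) (hδ.trans hBc)

/-- Delete the elements with the largest values of `f` one by one. -/
theorem exists_subset_card_eq_sum_le {f : V → ℝ} (hs : s ≤ #B) (hB : ∑ b ∈ B, f b ≤ c * #B) :
    ∃ B' ⊆ B, #B' = s ∧ ∑ b ∈ B', f b ≤ c * s := by
  classical
  induction hn : #B - s generalizing B with
  | zero =>
    obtain rfl : #B = s := by omega
    exact ⟨B, subset_rfl, rfl, hB⟩
  | succ n ih =>
    obtain ⟨b, hb, hmax⟩ := exists_max_image B f (card_pos.1 (by omega))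
    have hcard := card_erase_add_one hb
    have hsum : ∑ x ∈ B.erase b, f x ≤ c * #(B.erase b) := by
      rcases le_total c (f b) with hcb | hbc
      · rw [← add_sum_erase _ _ hb, ← hcard] at hB
        push_cast at hB
        linarith
      · rw [mul_comm, ← nsmul_eq_mul]
        exact sum_le_card_nsmul _ _ _ fun x hx => (hmax x (mem_of_mem_erase hx)).trans hbc
    obtain ⟨B', hB', hB's, hB'sum⟩ := ih (by omega) hsum (by omega)
    exact ⟨B', hB'.trans (erase_subset _ _), hB's, hB'sum⟩

open Classical in
theorem card_interedges_eq_sum (G : SimpleGraph V) (A B : Finset V) :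
    #(G.interedges A B) = ∑ a ∈ A, #{b ∈ B | G.Adj a b} := by
  simp only [SimpleGraph.interedges_def, card_filter, sum_product]

open Classical in
theorem card_interedges_comm (G : SimpleGraph V) (A B : Finset V) :
    #(G.interedges A B) = #(G.interedges B A) :=
  have : Std.Symm G.Adj := ⟨fun _ _ => SimpleGraph.Adj.symm⟩
  Rel.card_interedges_comm A B

open Classical in
theorem card_interedges_union_self (G : SimpleGraph V) (hAB : Disjoint A B) :
    #(G.interedges (A ∪ B) (A ∪ B)) =
      #(G.interedges A A) + 2 * #(G.interedges B A) + #(G.interedges B B) := by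
  have hsplit : ∀ C, #(G.interedges (A ∪ B) C) = #(G.interedges A C) + #(G.interedges B C) :=
    fun C => by simp only [card_interedges_eq_sum, sum_union hAB]
  rw [hsplit, card_interedges_comm G A, card_interedges_comm G B, hsplit, hsplit,
    card_interedges_comm G A B]
  ring

open Classical in
theorem IsSparseTo.exists_subset_card_interedges_le (h : IsSparseTo G η A B) (hs : s ≤ #B) :
    ∃ B' ⊆ B, #B' = s ∧ (#(G.interedges B' A) : ℝ) ≤ η * #A * s := by
  have hBA : ∑ b ∈ B, (#{a ∈ A | G.Adj b a} : ℝ) ≤ η * #A * #B := by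
    rw [← Nat.cast_sum, ← card_interedges_eq_sum, card_interedges_comm, card_interedges_eq_sum,
      Nat.cast_sum]
    calc ∑ a ∈ A, (#{b ∈ B | G.Adj a b} : ℝ) ≤ #A • (η * #B) := sum_le_card_nsmul _ _ _ h
      _ = η * #A * #B := by rw [nsmul_eq_mul]; ring
  simpa only [card_interedges_eq_sum, Nat.cast_sum] using exists_subset_card_eq_sum_le hs hBA

open Classical in
/-- Some `a * s` vertices in `W` span few edges: the set is to be thought of as `a` blocks of size
`s`, with arbitrary edges inside the blocks and density at most `η` between them. Edges are counted
as ordered pairs. -/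
def HasSparseSet (G : SimpleGraph V) (η : ℝ) (W : Finset V) (a s : ℕ) : Prop :=
  ∃ X ⊆ W, #X = a * s ∧ (#(G.interedges X X) : ℝ) ≤ (a + η * a ^ 2) * s ^ 2

theorem hasSparseSet_zero_left : HasSparseSet G η W 0 s := ⟨∅, by simp⟩

theorem hasSparseSet_zero_right : HasSparseSet G η W a 0 := ⟨∅, by simp⟩

theorem HasSparseSet.mono (h : HasSparseSet G η W a s) (hW : W ⊆ W') : HasSparseSet G η W' a s := by
  obtain ⟨X, hX, hcard, hedges⟩ := h
  exact ⟨X, hX.trans hW, hcard, hedges⟩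

theorem HasSparseSet.succ (hη : 0 ≤ η) (h : HasSparseSet G η A a s) (hAW : A ⊆ W) (hBW : B ⊆ W)
    (hAB : Disjoint A B) (hs : s ≤ #B) (hsparse : IsSparseTo G η A B) :
    HasSparseSet G η W (a + 1) s := by
  classical
  obtain ⟨X, hXA, hXcard, hXX⟩ := h
  obtain ⟨B', hB', hB's, hB'X⟩ := (hsparse.mono_left hXA).exists_subset_card_interedges_le hs
  have hdisj : Disjoint X B' := (hAB.mono_left hXA).mono_right hB'
  refine ⟨X ∪ B', union_subset (hXA.trans hAW) (hB'.trans hBW), ?_, ?_⟩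
  · rw [card_union_of_disjoint hdisj, hXcard, hB's]
    ring
  · have hB'B' : (#(G.interedges B' B') : ℝ) ≤ s * s := by
      exact_mod_cast hB's ▸ G.card_interedges_le_mul B' B'
    rw [hXcard] at hB'X
    rw [card_interedges_union_self G hdisj]
    push_cast at hB'X ⊢
    have : 0 ≤ η * (s : ℝ) ^ 2 := by positivity
    linarith

theorem HasSparsePairs.exists_hasSparseSet (h : HasSparsePairs G η δ) (hη : 0 ≤ η) (hδ : 0 ≤ δ)
    (hδ1 : δ ≤ 1) (a b : ℕ) (W : Finset V) :
    ∃ s ≤ #W, δ ^ (a + b) * #W ≤ s + 1 ∧ (HasSparseSet G η W a s ∨ HasSparseSet Gᶜ η W b s) := by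
  have hpow : ∀ (n : ℕ) (W : Finset V), δ ^ n * #W ≤ #W := fun n _ =>
    mul_le_of_le_one_left (Nat.cast_nonneg _) (pow_le_one₀ hδ hδ1)
  induction a generalizing b W with
  | zero => exact ⟨#W, le_rfl, (hpow _ _).trans (by simp), .inl hasSparseSet_zero_left⟩
  | succ a iha =>
    induction b generalizing W with
    | zero => exact ⟨#W, le_rfl, (hpow _ _).trans (by simp), .inr hasSparseSet_zero_left⟩
    | succ b ihb =>
      by_cases hW : 1 ≤ δ * #W
      · obtain ⟨A, hAW, B, hBW, hAB, hcard, hδA, hsparse⟩ := h W hW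
        have hsize : δ ^ (a + 1 + (b + 1)) * #W ≤ δ ^ (a + (b + 1)) * #A := by
          rw [show a + 1 + (b + 1) = a + (b + 1) + 1 by omega, pow_succ, mul_assoc]
          gcongr
        rcases hsparse with hsparse | hsparse
        · obtain ⟨s, hs, hδs, hX⟩ := iha (b + 1) A
          exact ⟨s, hs.trans (card_le_card hAW), hsize.trans hδs,
            hX.imp (·.succ hη hAW hBW hAB (hs.trans hcard) hsparse) (·.mono hAW)⟩
        · obtain ⟨s, hs, hδs, hX⟩ := ihb A
          rw [add_right_comm, add_assoc] at hδs
          exact ⟨s, hs.trans (card_le_card hAW), hsize.trans hδs,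
            hX.imp (·.mono hAW) (·.succ hη hAW hBW hAB (hs.trans hcard) hsparse)⟩
      · refine ⟨0, Nat.zero_le _, ?_, .inl hasSparseSet_zero_right⟩
        rw [← add_assoc, pow_succ, mul_assoc, Nat.cast_zero, zero_add]
        exact mul_le_one₀ (pow_le_one₀ hδ hδ1) (by positivity) (not_le.1 hW).le

open Classical in
/-- Markov's inequality for the degrees. -/
theorem exists_subset_isSparseTo_self (hc : 0 ≤ c) (hX : (#(G.interedges X X) : ℝ) ≤ c * #X ^ 2) :
    ∃ Y ⊆ X, #X ≤ 2 * #Y ∧ IsSparseTo G (4 * c) Y Y := by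
  let degree (x : V) : ℝ := #{z ∈ X | G.Adj x z}
  let Y : Finset V := {y ∈ X | degree y ≤ 2 * c * #X}
  have hYX : Y ⊆ X := filter_subset _ _
  have hcard : #X ≤ 2 * #Y := by
    by_contra! hlt
    have hsdiff : #X < 2 * #(X \ Y) := by
      have := card_sdiff_add_card_eq_card hYX
      omega
    have hne : (X \ Y).Nonempty := card_pos.1 (by omega)
    have hmarkov : #(X \ Y) * (2 * c * #X) < c * #X ^ 2 := by
      calc #(X \ Y) * (2 * c * #X) = ∑ _x ∈ X \ Y, 2 * c * #X := by
            rw [sum_const, nsmul_eq_mul]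
        _ < ∑ x ∈ X \ Y, degree x := by
            refine sum_lt_sum_of_nonempty hne fun x hx => not_le.1 fun hle => ?_
            exact (mem_sdiff.1 hx).2 (mem_filter.2 ⟨(mem_sdiff.1 hx).1, hle⟩)
        _ ≤ ∑ x ∈ X, degree x :=
            sum_le_sum_of_subset_of_nonneg sdiff_subset fun _ _ _ => Nat.cast_nonneg _
        _ = #(G.interedges X X) := by rw [card_interedges_eq_sum, Nat.cast_sum]
        _ ≤ c * #X ^ 2 := hX
    have hsdiff' : (#X : ℝ) ≤ 2 * #(X \ Y) := by exact_mod_cast hsdiff.le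
    have : c * #X * #X ≤ c * #X * (2 * #(X \ Y)) := by gcongr
    linarith
  refine ⟨Y, hYX, hcard, fun y hy => ?_⟩
  have hcard' : (#X : ℝ) ≤ 2 * #Y := by exact_mod_cast hcard
  calc (#{z ∈ Y | G.Adj y z} : ℝ) ≤ degree y :=
        Nat.cast_le.2 (card_le_card (filter_subset_filter _ hYX))
    _ ≤ 2 * c * #X := (mem_filter.1 hy).2
    _ ≤ 2 * c * (2 * #Y) := by gcongr
    _ = 4 * c * #Y := by ring

theorem HasSparseSet.exists_isSparseTo_self (hη : 0 ≤ η) (ha : 1 ≤ η * a)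
    (h : HasSparseSet G η W a s) : ∃ Y : Finset V, a * s ≤ 2 * #Y ∧ IsSparseTo G (8 * η) Y Y := by
  classical
  obtain ⟨X, -, hcard, hX⟩ := h
  have hdensity : (#(G.interedges X X) : ℝ) ≤ 2 * η * #X ^ 2 := by
    calc (#(G.interedges X X) : ℝ) ≤ (a + η * a ^ 2) * s ^ 2 := by convert hX
      _ ≤ (η * a * a + η * a ^ 2) * s ^ 2 := by
          gcongr
          exact le_mul_of_one_le_left (Nat.cast_nonneg a) ha
      _ = 2 * η * #X ^ 2 := by
          rw [hcard]
          push_cast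
          ring
  obtain ⟨Y, -, hY, hsparse⟩ := exists_subset_isSparseTo_self (by positivity) hdensity
  exact ⟨Y, hcard ▸ hY, hsparse.mono (by linarith)⟩

theorem HasSparsePairs.exists_isSparseTo_self_or_compl [Fintype V] (h : HasSparsePairs G η δ)
    (hη : 0 ≤ η) (hδ : 0 ≤ δ) (hδ1 : δ ≤ 1) {K : ℕ} (hK : 4 ≤ K) (hηK : 1 ≤ η * K)
    (hV : 2 ≤ δ ^ (K + K) * Fintype.card V) :
    ∃ Y : Finset V, 2 ≤ #Y ∧ δ ^ (K + K) * Fintype.card V ≤ 2 * #Y ∧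
      (IsSparseTo G (8 * η) Y Y ∨ IsSparseTo Gᶜ (8 * η) Y Y) := by
  obtain ⟨s, -, hs, hX⟩ := h.exists_hasSparseSet hη hδ hδ1 K K univ
  rw [card_univ] at hs
  obtain ⟨Y, hY, hsparse⟩ : ∃ Y : Finset V, K * s ≤ 2 * #Y ∧
      (IsSparseTo G (8 * η) Y Y ∨ IsSparseTo Gᶜ (8 * η) Y Y) := by
    rcases hX with hX | hX
    · exact (hX.exists_isSparseTo_self hη hηK).imp fun Y hY => hY.imp_right .inl
    · exact (hX.exists_isSparseTo_self hη hηK).imp fun Y hY => hY.imp_right .inr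
  have one_le_s : 1 ≤ s := by
    have : (1 : ℝ) ≤ s := by linarith
    exact_mod_cast this
  have two_mul_s_le : 2 * s ≤ #Y := by nlinarith
  have card_le : δ ^ (K + K) * Fintype.card V ≤ 2 * #Y := by
    have : (s + 1 : ℝ) ≤ 2 * #Y := by exact_mod_cast (by omega : s + 1 ≤ 2 * #Y)
    linarith
  exact ⟨Y, by omega, card_le, hsparse⟩

theorem exists_isSparseTo_self_or_compl {ε : ℝ} (hε : 0 < ε) (H : SimpleGraph (Fin h)) :
    ∃ δ : ℝ, 0 < δ ∧ δ ≤ 1 ∧ ∀ (V : Type u) [Fintype V] (G : SimpleGraph V),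
      ¬ H.IsIndContained G → 1 ≤ δ * Fintype.card V →
        ∃ Y : Finset V, 2 ≤ #Y ∧ δ * Fintype.card V ≤ #Y ∧
          (IsSparseTo G ε Y Y ∨ IsSparseTo Gᶜ ε Y Y) := by
  obtain ⟨η, hη, hη1, hηε⟩ : ∃ η : ℝ, 0 < η ∧ η ≤ 1 ∧ 8 * η ≤ ε :=
    ⟨min 1 (ε / 8), by positivity, min_le_left _ _, by linarith [min_le_right 1 (ε / 8)]⟩
  let K := max 4 ⌈1 / η⌉₊
  have hηK : 1 ≤ η * K := (div_le_iff₀' hη).1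
    ((Nat.le_ceil _).trans (by exact_mod_cast le_max_right 4 ⌈1 / η⌉₊))
  let δ₀ : ℝ := η ^ h / (2 * (h + 1) ^ 2)
  have hδ₀ : 0 < δ₀ := by positivity
  have hδ₀1 : δ₀ ≤ 1 := by
    refine div_le_one_of_le₀ ((pow_le_one₀ hη.le hη1).trans ?_) (by positivity)
    nlinarith [Nat.cast_nonneg (α := ℝ) h]
  have hδ1 := pow_le_one₀ (n := K + K) hδ₀.le hδ₀1
  refine ⟨δ₀ ^ (K + K) / 2, by positivity, by linarith, fun V _ G hG hV => ?_⟩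
  obtain ⟨Y, hY, hcard, hsparse⟩ :=
    (hasSparsePairs_of_not_isIndContained hη hη1 hG).exists_isSparseTo_self_or_compl hη.le hδ₀.le
      hδ₀1 (le_max_left 4 _) hηK (by linarith)
  exact ⟨Y, hY, by linarith, hsparse.imp (·.mono hηε) (·.mono hηε)⟩

end Rodl

/-! ### Pure pairs -/

section PurePair

open Finset

open scoped Topology

universe u

variable {V : Type*} {G : SimpleGraph V} {A B Y : Finset V} {a b : ℝ}

theorem isPurePair_singleton {x y : V} (hxy : x ≠ y) : IsPurePair G {x} {y} := by
  refine ⟨by simpa using hxy, ?_⟩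
  by_cases hadj : G.Adj x y
  · exact .inl (by simpa [SimpleGraph.IsCompleteBetween] using hadj)
  · exact .inr (by simpa [IsAnticomplete] using hadj)

theorem IsAnticomplete.isPurePair_of_compl (h : IsAnticomplete Gᶜ A B) (hAB : Disjoint A B) :
    IsPurePair G A B := by
  refine ⟨hAB, .inl fun a ha b hb => ?_⟩
  by_contra hadj
  exact h a ha b hb ⟨disjoint_iff_ne.1 hAB a ha b hb, hadj⟩

theorem exists_isAnticomplete_of_not_noAnticompletePair
    (h : ¬ NoAnticompletePair (G.induce (Y : Set V)) a b) :
    ∃ A B : Finset V, Disjoint A B ∧ IsAnticomplete G A B ∧ a ≤ #A ∧ b ≤ #B := by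
  classical
  unfold NoAnticompletePair at h
  push Not at h
  obtain ⟨A, B, hAB, hA, hB, hanti⟩ := h
  refine ⟨A.toFinset.map (.subtype _), B.toFinset.map (.subtype _), ?_, ?_, ?_, ?_⟩
  · rwa [disjoint_map, Set.disjoint_toFinset]
  · simp only [IsAnticomplete, mem_map, Set.mem_toFinset]
    rintro _ ⟨x, hx, rfl⟩ _ ⟨y, hy, rfl⟩
    exact hanti x hx y hy
  · rwa [card_map, ← Set.ncard_eq_toFinset_card']
  · rwa [card_map, ← Set.ncard_eq_toFinset_card']

open Classical in
theorem ncard_neighborSet_induce (G : SimpleGraph V) (Y : Finset V) (x : (Y : Set V)) :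
    ((G.induce (Y : Set V)).neighborSet x).ncard = #{z ∈ Y | G.Adj x z} := by
  rw [← Set.ncard_image_of_injective _ Subtype.val_injective, ← Set.ncard_coe_finset]
  congr 1
  ext z
  simp [and_comm]

theorem eventually_exists_isAnticomplete_of_isSparseTo (t ℓ : ℕ) (hℓ : 4 * (t + 1) + 5 ≤ ℓ) :
    ∀ᶠ ε : ℝ in 𝓝[>] 0, ∀ (V : Type u) (G : SimpleGraph V) (Y : Finset V), 2 ≤ #Y →
      IsSparseTo G ε Y Y → ¬ (SimpleGraph.cycleGraph ℓ).IsIndContained G →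
        ∃ A B : Finset V, Disjoint A B ∧ IsAnticomplete G A B ∧ ε * #Y ≤ #A ∧
          ε * (#Y : ℝ) ^ (1 - 1 / ((t : ℝ) + 1)) ≤ #B := by
  obtain ⟨ε₀, hε₀, hpair⟩ := exists_not_noAnticompletePair_of_sparse.{u} t ℓ hℓ
  filter_upwards [Ioo_mem_nhdsGT hε₀] with ε hε V G Y hY hsparse hfree
  have hcard : Nat.card Y = #Y := by simp
  have hY1 : (1 : ℝ) ≤ #Y := by exact_mod_cast one_le_two.trans hY
  let N : ℝ := (#Y : ℝ) ^ (1 / ((t : ℝ) + 1))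
  have hpow (j : ℕ) : N ^ j = (#Y : ℝ) ^ (1 / ((t : ℝ) + 1) * j) :=
    (Real.rpow_mul_natCast (by positivity) _ _).symm
  have hN_succ : N ^ (t + 1) = #Y := by
    rw [hpow, Nat.cast_succ, one_div_mul_cancel (by positivity), Real.rpow_one]
  have hN : N ^ t = (#Y : ℝ) ^ (1 - 1 / ((t : ℝ) + 1)) := by
    rw [hpow]
    congr 1
    field_simp
    ring
  have : Nontrivial (Y : Set V) := (one_lt_card_iff_nontrivial.1 hY).coe_sort
  obtain ⟨A, B, hAB, hanti, hA, hB⟩ := exists_isAnticomplete_of_not_noAnticompletePair <|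
    hpair Y (G.induce (Y : Set V)) N (Real.one_le_rpow hY1 (by positivity)) (by rw [hcard, hN_succ])
      (fun x => by
        rw [hcard, ncard_neighborSet_induce]
        exact (hsparse x x.2).trans_lt (by gcongr; exact hε.2))
      fun hind => hfree (hind.trans ⟨SimpleGraph.Embedding.induce _⟩)
  rw [hN_succ] at hA
  rw [hN] at hB
  exact ⟨A, B, hAB, hanti, le_trans (by gcongr; exact hε.2.le) hA,
    le_trans (by gcongr; exact hε.2.le) hB⟩

theorem mul_rpow_le_rpow {δ n m r : ℝ} (hδ : 0 < δ) (hδ1 : δ ≤ 1) (hn : 0 ≤ n) (hr : 0 ≤ r)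
    (hr1 : r ≤ 1) (h : δ * n ≤ m) : δ * n ^ r ≤ m ^ r := by
  calc δ * n ^ r ≤ δ ^ r * n ^ r := by
        gcongr
        simpa using Real.rpow_le_rpow_of_exponent_ge hδ hδ1 hr1
    _ = (δ * n) ^ r := (Real.mul_rpow hδ.le hn).symm
    _ ≤ m ^ r := by gcongr

theorem eventually_exists_isPurePair_of_isSparseTo_or_compl (t l₁ l₂ : ℕ)
    (hl₁ : 4 * (t + 1) + 5 ≤ l₁) (hl₂ : 4 * (t + 1) + 5 ≤ l₂) :
    ∀ᶠ ε : ℝ in 𝓝[>] 0, ∀ (V : Type u) (G : SimpleGraph V) (Y : Finset V), 2 ≤ #Y →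
      (IsSparseTo G ε Y Y ∨ IsSparseTo Gᶜ ε Y Y) → ¬ HasHole G l₁ → ¬ HasAntihole G l₂ →
        ∃ A B : Finset V, IsPurePair G A B ∧ ε * #Y ≤ #A ∧
          ε * (#Y : ℝ) ^ (1 - 1 / ((t : ℝ) + 1)) ≤ #B := by
  filter_upwards [eventually_exists_isAnticomplete_of_isSparseTo.{u} t l₁ hl₁,
    eventually_exists_isAnticomplete_of_isSparseTo.{u} t l₂ hl₂]
    with ε hsparse hdense V G Y hY hYG hhole hantihole
  rcases hYG with hYG | hYG
  · obtain ⟨A, B, hAB, hanti, hA, hB⟩ := hsparse V G Y hY hYG fun h => hhole ⟨by omega, h⟩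
    exact ⟨A, B, ⟨hAB, .inr hanti⟩, hA, hB⟩
  · obtain ⟨A, B, hAB, hanti, hA, hB⟩ := hdense V Gᶜ Y hY hYG fun h => hantihole ⟨by omega, h⟩
    exact ⟨A, B, hanti.isPurePair_of_compl hAB, hA, hB⟩

theorem exists_isPurePair (t l₁ l₂ : ℕ) (hl₁ : 4 * (t + 1) + 5 ≤ l₁) (hl₂ : 4 * (t + 1) + 5 ≤ l₂) :
    ∃ ε : ℝ, 0 < ε ∧ ∀ (V : Type u) [Fintype V] (G : SimpleGraph V), 1 < Fintype.card V →
      ¬ HasHole G l₁ → ¬ HasAntihole G l₂ → ∃ A B : Finset V, IsPurePair G A B ∧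
        ε * Fintype.card V ≤ #A ∧ ε * (Fintype.card V : ℝ) ^ (1 - 1 / ((t : ℝ) + 1)) ≤ #B := by
  obtain ⟨ε, hpair, hε, hε1⟩ := ((eventually_exists_isPurePair_of_isSparseTo_or_compl.{u}
    t l₁ l₂ hl₁ hl₂).and (Ioo_mem_nhdsGT one_pos)).exists
  obtain ⟨δ, hδ, hδ1, hrodl⟩ := exists_isSparseTo_self_or_compl.{u} hε (SimpleGraph.cycleGraph l₁)
  have hr : 0 ≤ 1 - 1 / ((t : ℝ) + 1) := sub_nonneg.2 (div_le_one_of_le₀ (by simp) (by positivity))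
  have hr1 : 1 - 1 / ((t : ℝ) + 1) ≤ 1 := sub_le_self _ (by positivity)
  refine ⟨ε * δ, by positivity, fun V _ G hV hhole hantihole => ?_⟩
  rw [mul_assoc, mul_assoc]
  by_cases hlarge : 1 ≤ δ * Fintype.card V
  · obtain ⟨Y, hY2, hYδ, hY⟩ := hrodl V G (fun h => hhole ⟨by omega, h⟩) hlarge
    obtain ⟨A, B, hAB, hA, hB⟩ := hpair V G Y hY2 hY hhole hantihole
    refine ⟨A, B, hAB, le_trans (by gcongr) hA, le_trans ?_ hB⟩
    gcongr
    exact mul_rpow_le_rpow hδ hδ1 (by positivity) hr hr1 hYδ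
  · obtain ⟨x, y, hxy⟩ := Fintype.one_lt_card_iff.1 hV
    have hsmall : δ * Fintype.card V ≤ 1 := (not_le.1 hlarge).le
    have hsmall_rpow := mul_rpow_le_rpow hδ hδ1 (by positivity) hr hr1 hsmall
    rw [Real.one_rpow] at hsmall_rpow
    refine ⟨{x}, {y}, isPurePair_singleton hxy, ?_, ?_⟩
    · simpa using mul_le_one₀ hε1.le (by positivity) hsmall
    · simpa using mul_le_one₀ hε1.le (by positivity) hsmall_rpow

end PurePair

end PurePairs

theorem mainTheorem3 (c : ℝ) (hc : 0 < c) (hint : ∃ k : ℤ, 1 / c = (k : ℝ))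
    (l₁ l₂ : ℕ) (hl₁ : 4 / c + 5 ≤ (l₁ : ℝ)) (hl₂ : 4 / c + 5 ≤ (l₂ : ℝ)) :
    ∃ ε : ℝ, 0 < ε ∧
      ∀ (V : Type*) [Fintype V] (G : SimpleGraph V), 1 < Fintype.card V →
        ¬ PurePairs.HasHole G l₁ → ¬ PurePairs.HasAntihole G l₂ →
        ∃ A B : Finset V, PurePairs.IsPurePair G A B ∧
          ε * (Fintype.card V : ℝ) ≤ (A.card : ℝ) ∧
          ε * (Fintype.card V : ℝ) ^ (1 - c) ≤ (B.card : ℝ) := by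
  obtain ⟨t, rfl⟩ : ∃ t : ℕ, c = 1 / ((t : ℝ) + 1) := by
    obtain ⟨k, hk⟩ := hint
    have hk_pos : 0 < k := by
      have : (0 : ℝ) < k := hk ▸ one_div_pos.2 hc
      exact_mod_cast this
    obtain ⟨t, rfl⟩ := Int.eq_succ_of_zero_lt hk_pos
    exact ⟨t, by simpa using (one_div_one_div c).symm.trans (congrArg (1 / ·) hk)⟩
  rw [div_div_eq_mul_div, div_one] at hl₁ hl₂
  exact PurePairs.exists_isPurePair t l₁ l₂ (by exact_mod_cast hl₁) (by exact_mod_cast hl₂)
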